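/- Consider an open network of $J$ infinite server queues, empty before the first arrival, specified as follows. * Batches arrive at the points $T_1<T_2<\dots$ of a homogeneous Poisson process on $[0,\infty)$ with constant rate $\lambda>0$. * The $i$-th batch contains $\Sigma_{ij}$ customers entering at queue $j$ ($j=1,\dots,J$). The vectors $\mathbf{\Sigma}_i=(\Sigma_{i1},\dots,\Sigma_{iJ})\in\mathbb{Z}_{\ge 0}^J$ are i.i.d. copies of a random vector $\mathbf{S}=(S_1,\dots,S_J)$ with probability generating function $G_{\mathbf S}(z_1,\dots,z_J)=\mathbb{E}\big[\prod_{j=1}^J z_j^{S_j}\big]$. * The $\ell$-th customer of the $i$-th batch among those entering at queue $j$ follows a random route: $X^j_{i,\ell}(t)=k$ if this customer is in queue $k\in\{1,\dots,J\}$ at time $T_i+t$, and at times at which the customer is not in the network $X^j_{i,\ell}(t)$ takes none of the values $1,\dots,J$. Each route is a measurable stochastic process (jointly measurable in time and in the route), with $P(X^j_{i,\ell}(t)=k)=q^j_k(t)$ for all $t\ge 0$. * The arrival process, all the batch size vectors $\mathbf{\Sigma}_i$ and all the routes $X^j_{i,\ell}$ are mutually independent. Let $Q_j(t)=\sum_{k=1}^J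 q^j_k(t)$ be the probability that a customer who entered at queue $j$ is in the network at time $t$ after its arrival. Let $\mathbf{N}(t)=(N_1(t),\dots,N_J(t))$, where $N_k(t)=\sum_{i:\,T_i\le t}\sum_{j=1}^J\sum_{\ell=1}^{\Sigma_{ij}}\mathbf{1}\{X^j_{i,\ell}(t-T_i)=k\}$ is the number of customers in queue $k$ at time $t$. For a batch, let $W\in[0,\infty]$ be the total time during which at least one of its customers is in the network. **Theorem 4.1.** For every batch, the expected occupancy time is $$\mathbb{E}[W]=\int_0^\infty\Big[1-G_{\mathbf S}\big(1-Q_1(\tau),\dots,1-Q_J(\tau)\big)\Big]\,d\tau\in[0,\infty].$$ The network is ergodic if and only if $\mathbb{E}[W]<\infty$. Here the network is called ergodic if $\mathbf{N}(t)$ has a proper limiting distribution, that is, if there is a probability distribution $p$ on $\mathbb{Z}_{\ge 0}^J$ such that $P(\mathbf{N}(t)=\mathbf{n})\to p(\mathbf{n})$ as $t\to\infty$ for every $\mathbf{n}\in\mathbb{Z}_{\ge 0}^J$. -/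

import Mathlib

open MeasureTheory ProbabilityTheory Filter Topology
open scoped NNReal ENNReal

namespace BatchNetwork

/-- The number of indices `i` for which the point `T i` lies in the set `A`. -/
noncomputable def arrivalCount {Ω : Type*} (T : ℕ → Ω → ℝ) (A : Set ℝ) (ω : Ω) : ℕ∞ :=
  {i : ℕ | T i ω ∈ A}.encard

/-- `T 0 < T 1 < ...` are the points of a homogeneous Poisson process on `[0, ∞)` with rate `lam`:
the number of points in a Borel set of finite length is Poisson distributed with mean `lam` times
the length, and the numbers of points in pairwise disjoint Borel sets are independent. -/
structure IsPoissonProcess {Ω : Type*} [MeasurableSpace Ω] (P : Measure Ω) (lam : ℝ≥0)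
    (T : ℕ → Ω → ℝ) : Prop where
  measurable : ∀ i, Measurable (T i)
  nonneg : ∀ᵐ ω ∂P, ∀ i, 0 ≤ T i ω
  strictMono : ∀ᵐ ω ∂P, StrictMono fun i => T i ω
  hasLaw_count : ∀ A : Set ℝ, MeasurableSet A → A ⊆ Set.Ici 0 → volume A ≠ ∞ →
    HasLaw (arrivalCount T A)
      ((poissonMeasure (lam * (volume A).toNNReal)).map (Nat.cast : ℕ → ℕ∞)) P
  indep_count : ∀ (m : ℕ) (A : Fin m → Set ℝ), (∀ a, MeasurableSet (A a)) →
    (∀ a, A a ⊆ Set.Ici 0) → (∀ a, volume (A a) ≠ ∞) → Pairwise (Function.onFun Disjoint A) →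
    iIndepFun (fun a => arrivalCount T (A a)) P

/-- The sources of randomness in the network: the arrival points, the size vector of the `i`-th
batch, and the route of the `l`-th customer of the `i`-th batch among those entering at queue
`j`. -/
inductive Source (J : ℕ) : Type
  | arrivals : Source J
  | batch (i : ℕ) : Source J
  | customer (i : ℕ) (j : Fin J) (l : ℕ) : Source J

/-- The σ-algebra generated by the route of a customer. Here `X t ω = some k` means that the
customer is in queue `k` at time `t` after its arrival, and `X t ω = none` that it is in none of the
queues. -/
@[reducible] def routeSigma {Ω : Type*} {J : ℕ} (X : ℝ → Ω → Option (Fin J)) : MeasurableSpace Ω :=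
  MeasurableSpace.generateFrom {s | ∃ t k, 0 ≤ t ∧ s = {ω | X t ω = some k}}

/-- The σ-algebra generated by each of the sources of randomness. -/
@[reducible] def sourceSigma {Ω : Type*} {J : ℕ} (T : ℕ → Ω → ℝ) (S : ℕ → Ω → Fin J → ℕ)
    (X : ℕ → Fin J → ℕ → ℝ → Ω → Option (Fin J)) : Source J → MeasurableSpace Ω
  | .arrivals => ⨆ i, MeasurableSpace.comap (T i) inferInstance
  | .batch i => MeasurableSpace.comap (S i) inferInstance
  | .customer i j l => routeSigma (X i j l)

/-- The open network of `J` infinite server queues with arrival rate `lam`, batch size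
distribution `ν`, and location probabilities `q j k t` (the probability that a customer who entered
at queue `j` is in queue `k` at time `t` after its arrival).

Batch `i` arrives at time `T i` and contains `S i ω j` customers entering at queue `j`, which are
labelled by `l < S i ω j`; `X i j l` is the route of the `l`-th of them.
The field `measurable_route` is joint measurability of the route in time and chance, relative to
the σ-algebra generated by the route itself; it holds, for instance, for right-continuous
piecewise constant routes. -/
structure IsNetwork {Ω : Type*} [MeasurableSpace Ω] (P : Measure Ω) {J : ℕ} (lam : ℝ≥0)
    (ν : PMF (Fin J → ℕ)) (q : Fin J → Fin J → ℝ → ℝ) (T : ℕ → Ω → ℝ)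
    (S : ℕ → Ω → Fin J → ℕ) (X : ℕ → Fin J → ℕ → ℝ → Ω → Option (Fin J)) : Prop where
  poisson : IsPoissonProcess P lam T
  measurable_batch : ∀ i, Measurable (S i)
  batch_law : ∀ i n, P {ω | S i ω = n} = ν n
  measurableSet_route : ∀ i j l t k, 0 ≤ t → MeasurableSet {ω | X i j l t ω = some k}
  measurable_route : ∀ i j l k,
    MeasurableSet[(inferInstance : MeasurableSpace ℝ).prod (routeSigma (X i j l))]
      {p : ℝ × Ω | 0 ≤ p.1 ∧ X i j l p.1 p.2 = some k}
  route_law : ∀ i j l k t, 0 ≤ t → P.real {ω | X i j l t ω = some k} = q j k t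
  indep : iIndep (sourceSigma T S X) P

/-- `N_k(t)`: the number of customers in queue `k` at time `t`, the network being empty before
the first arrival. -/
noncomputable def occupancy {Ω : Type*} {J : ℕ} (T : ℕ → Ω → ℝ) (S : ℕ → Ω → Fin J → ℕ)
    (X : ℕ → Fin J → ℕ → ℝ → Ω → Option (Fin J)) (t : ℝ) (k : Fin J) (ω : Ω) : ℕ∞ :=
  {c : ℕ × Fin J × ℕ | T c.1 ω ≤ t ∧ c.2.2 < S c.1 ω c.2.1 ∧
    X c.1 c.2.1 c.2.2 (t - T c.1 ω) ω = some k}.encard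

/-- The network is ergodic: the vector `N(t)` has a proper limiting distribution, i.e. its point
probabilities converge to those of a probability distribution on `ℕ^J` as `t → ∞`. -/
def IsErgodic {Ω : Type*} [MeasurableSpace Ω] (P : Measure Ω) {J : ℕ} (T : ℕ → Ω → ℝ)
    (S : ℕ → Ω → Fin J → ℕ) (X : ℕ → Fin J → ℕ → ℝ → Ω → Option (Fin J)) : Prop :=
  ∃ p : PMF (Fin J → ℕ), ∀ n : Fin J → ℕ,
    Tendsto (fun t : ℝ => P {ω | ∀ k, occupancy T S X t k ω = n k}) atTop (𝓝 (p n))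

/-- `W` for the `i`-th batch: the total time during which at least one customer of the batch is
present in the network. -/
noncomputable def batchOccupancyTime {Ω : Type*} {J : ℕ} (S : ℕ → Ω → Fin J → ℕ)
    (X : ℕ → Fin J → ℕ → ℝ → Ω → Option (Fin J)) (i : ℕ) (ω : Ω) : ℝ≥0∞ :=
  volume {t : ℝ | 0 ≤ t ∧ ∃ j, ∃ l < S i ω j, ∃ k, X i j l t ω = some k}

/-- The probability generating function `G_S` of the batch size distribution. -/
noncomputable def batchPGF {J : ℕ} (ν : PMF (Fin J → ℕ)) (z : Fin J → ℝ) : ℝ :=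
  ∑' n : Fin J → ℕ, (ν n).toReal * ∏ j, z j ^ n j

/-- `Q_j(t)`: the probability that a customer who entered at queue `j` is still in the network
at time `t` after its arrival. -/
def stayProb {J : ℕ} (q : Fin J → Fin J → ℝ → ℝ) (j : Fin J) (t : ℝ) : ℝ := ∑ k, q j k t

/-- The integral `∫₀^∞ [1 - G_S(1 - Q_1(τ), …, 1 - Q_J(τ))] dτ`, with values in `[0, ∞]`. -/
noncomputable def occupancyIntegral {J : ℕ} (ν : PMF (Fin J → ℕ))
    (q : Fin J → Fin J → ℝ → ℝ) : ℝ≥0∞ :=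
  ∫⁻ τ in Set.Ioi (0 : ℝ), ENNReal.ofReal (1 - batchPGF ν fun j => 1 - stayProb q j τ)

end BatchNetwork

/-! ### Generating functional of the Poisson process -/

namespace BatchNetwork

/-! Write `κ_s(τ)` for `killProb ν q s τ`; `κ_0(τ)` is the probability that some customer of a batch
is present at age `τ`. Given the batch sizes the routes are independent, so nobody is present with
conditional probability `∏ (1 - Q_j)^{S_j}`, whose mean is a value of `G_S`. Tonelli then gives
`E[W] = ∫ κ_0` (`lintegral_batchOccupancyTime`).

Ergodicity rests on one formula. Give each customer present at time `t` in queue `k` the weight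
`z_k`. Integrating out routes, then batch sizes, then the Poisson points shows that the customers
who arrived in `D ⊆ [0, t]` have generating function `exp(-λ ∫_D (1 - G_S(w(t - u))) du)`, where
`w_j` is the mean weight of one customer (`integral_prod_pow_countVec`).

If `∫ κ_0 < ∞`: the formula depends on ages only, so the customers who arrived in `(t - s, t]` have
the law of `N(s)`, while some older customer is still present with probability at most `λ ∫_s^t κ_0`
(`measureReal_map_countVec_ge`). Hence the laws of `N(t)` are Cauchy in total variation, and no mass
escapes in the limit (`exists_pmf_tendsto`).

If `∫ κ_0 = ∞`: taking all `z_k = 1/2` gives `E[2^{-|N(t)|}] = exp(-λ ∫_0^t κ_{1/2})`. Since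
`κ_{1/2} ≥ κ_0 / 2`, this tends to `0`, and so does `P(N(t) = n) ≤ 2^{|n|} E[2^{-|N(t)|}]` for every
`n`. All limits vanish, so they do not form a probability distribution. -/

lemma integral_pow_poissonMeasure (r : ℝ≥0) (c : ℂ) :
    ∫ n : ℕ, c ^ n ∂(poissonMeasure r) = Complex.exp (-(r * (1 - c))) := by
  rw [integral_poissonMeasure]
  have h := (NormedSpace.expSeries_div_hasSum_exp ((r : ℂ) * c)).mul_left (Complex.exp (-r))
  rw [← Complex.exp_eq_exp_ℂ, ← Complex.exp_add] at h
  rw [show -(r * (1 - c)) = -(r : ℂ) + r * c by ring, ← h.tsum_eq]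
  congr 1
  ext n
  rw [Complex.real_smul]
  push_cast
  rw [mul_pow]
  ring

/-- Freezing: of two independent random variables, one may be treated as a constant when
integrating out the other. -/
lemma integral_eq_integral_integral_of_indepFun {Ω Ω' E : Type*} [MeasurableSpace E]
    [MeasurableSpace Ω] [MeasurableSpace Ω'] {P : Measure Ω} [IsProbabilityMeasure P]
    {Y : Ω → E} {g : Ω → Ω'} (hY : Measurable Y) (hg : Measurable g) (hind : IndepFun Y g P)
    {F : E × Ω' → ℂ} (hF : Measurable F) (hbd : ∀ p, ‖F p‖ ≤ 1) :
    ∫ ω, F (Y ω, g ω) ∂P = ∫ ω, ∫ ω', F (Y ω, g ω') ∂P ∂P := by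
  have hmap := (indepFun_iff_map_prod_eq_prod_map_map hY.aemeasurable hg.aemeasurable).1 hind
  have : IsProbabilityMeasure (P.map Y) := Measure.isProbabilityMeasure_map hY.aemeasurable
  have : IsProbabilityMeasure (P.map g) := Measure.isProbabilityMeasure_map hg.aemeasurable
  rw [← integral_map (hY.prodMk hg).aemeasurable hF.aestronglyMeasurable, hmap,
    integral_prod _ (Integrable.of_bound hF.aestronglyMeasurable 1 (ae_of_all _ hbd)),
    integral_map hY.aemeasurable hF.stronglyMeasurable.integral_prod_right'.aestronglyMeasurable]
  congr 1
  ext ω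
  exact integral_map hg.aemeasurable (hF.comp measurable_prodMk_left).aestronglyMeasurable

/-- Freezing a random variable independent of a σ-algebra `m` when integrating out the randomness
in `m`. -/
lemma integral_eq_integral_integral_of_indep {Ω E : Type*} [mE : MeasurableSpace E]
    {m mΩ : MeasurableSpace Ω} {P : Measure Ω} [IsProbabilityMeasure P] (hm : m ≤ mΩ)
    {Y : Ω → E} (hY : Measurable Y) (hind : Indep (MeasurableSpace.comap Y mE) m P)
    {F : E × Ω → ℂ} (hF : @Measurable _ _ (mE.prod m) _ F) (hbd : ∀ p, ‖F p‖ ≤ 1) :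
    ∫ ω, F (Y ω, ω) ∂P = ∫ ω, ∫ ω', F (Y ω, ω') ∂P ∂P :=
  @integral_eq_integral_integral_of_indepFun Ω Ω E mE mΩ m P _ Y id hY (measurable_id'' hm)
    ((@IndepFun_iff_Indep _ _ _ mΩ mE m _ _ _).2 ((@MeasurableSpace.comap_id Ω m).symm ▸ hind)) F hF hbd

variable {Ω : Type*} [MeasurableSpace Ω] {P : Measure Ω} {lam : ℝ≥0} {T : ℕ → Ω → ℝ}

lemma IsPoissonProcess.ae_finite (h : IsPoissonProcess P lam T) {D : Set ℝ}
    (hD : MeasurableSet D) (hD0 : D ⊆ Set.Ici 0) (hDv : volume D ≠ ∞) :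
    ∀ᵐ ω ∂P, {i | T i ω ∈ D}.Finite := by
  have h1 := (h.hasLaw_count D hD hD0 hDv).ae_iff (p := fun n => n ≠ ⊤) (Measurable.of_discrete)
  have h2 : ∀ᵐ n ∂((poissonMeasure (lam * (volume D).toNNReal)).map (Nat.cast : ℕ → ℕ∞)),
      n ≠ ⊤ := by
    rw [ae_map_iff (by fun_prop) (MeasurableSet.of_discrete)]
    simp
  filter_upwards [h1.2 h2] with ω hω
  exact Set.encard_ne_top_iff.1 hω

lemma finprod_ite_eq_prod {M : Type*} [CommMonoid M] {T : ℕ → ℝ} {D : Set ℝ} [DecidablePred (· ∈ D)]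
    (hfin : {i | T i ∈ D}.Finite) (f : ℝ → M) :
    ∏ᶠ i, (if T i ∈ D then f (T i) else 1) = ∏ i ∈ hfin.toFinset, f (T i) := by
  rw [finprod_eq_prod_of_mulSupport_subset (s := hfin.toFinset)]
  · exact Finset.prod_congr rfl fun i hi => if_pos (by simpa using hi)
  · intro i hi
    by_contra hc
    apply hi
    exact if_neg (by simpa using hc)

lemma tendsto_prod_range_finprod {T : ℕ → ℝ} {D : Set ℝ} [DecidablePred (· ∈ D)]
    (hfin : {i | T i ∈ D}.Finite) (f : ℕ → ℂ) :
    Tendsto (fun n => ∏ i ∈ Finset.range n, (if T i ∈ D then f i else 1)) atTop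
      (𝓝 (∏ i ∈ hfin.toFinset, f i)) := by
  obtain ⟨N, hN⟩ := hfin.bddAbove
  apply tendsto_const_nhds.congr'
  filter_upwards [eventually_gt_atTop N] with n hn
  have hsub : hfin.toFinset ⊆ Finset.range n := by
    intro i hi
    have : i ≤ N := hN (by simpa using hi)
    simp; omega
  rw [← Finset.prod_subset hsub]
  · exact Finset.prod_congr rfl fun i hi => (if_pos (by simpa using hi)).symm
  · intro i _ hi
    exact if_neg (by simpa using hi)

lemma norm_prod_le_one {ι : Type*} (s : Finset ι) (f : ι → ℂ) (hf : ∀ i ∈ s, ‖f i‖ ≤ 1) :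
    ‖∏ i ∈ s, f i‖ ≤ 1 := by
  rw [norm_prod]
  exact Finset.prod_le_one (fun _ _ => norm_nonneg _) hf

open Classical in
-- A simple function is constant on its fibres, so the product becomes `∏ c_a ^ N(A_a)` with
-- independent Poisson counts on the disjoint pieces `A_a` of `D`, and each factor has an explicit
-- mean.
lemma IsPoissonProcess.integral_finprod_simpleFunc (h : IsPoissonProcess P lam T)
    [IsProbabilityMeasure P] {D : Set ℝ}
    (hD : MeasurableSet D) (hD0 : D ⊆ Set.Ici 0) (hDv : volume D ≠ ∞)
    (ψ : SimpleFunc ℝ ℂ) (hψ : ∀ x, ‖ψ x‖ ≤ 1) :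
    ∫ ω, ∏ᶠ i, (if T i ω ∈ D then ψ (T i ω) else 1) ∂P
      = Complex.exp (-(lam * ∫ u in D, (1 - ψ u))) := by
  set e := ψ.range.equivFin with he
  set m := ψ.range.card with hm
  let A : Fin m → Set ℝ := fun a => D ∩ ψ ⁻¹' {(e.symm a : ℂ)}
  have hA : ∀ a, MeasurableSet (A a) := fun a => hD.inter (ψ.measurableSet_fiber _)
  have hA0 : ∀ a, A a ⊆ Set.Ici 0 := fun a => Set.inter_subset_left.trans hD0
  have hAv : ∀ a, volume (A a) ≠ ∞ := fun a => measure_ne_top_of_subset Set.inter_subset_left hDv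
  have hdisj : Pairwise (Function.onFun Disjoint A) := by
    intro a b hab
    rw [Function.onFun, Set.disjoint_left]
    rintro x ⟨_, hx⟩ ⟨_, hx'⟩
    simp only [Set.mem_preimage, Set.mem_singleton_iff] at hx hx'
    exact hab (e.symm.injective (Subtype.ext (hx.symm.trans hx')))
  have hUn : ⋃ a, A a = D := by
    ext x
    simp only [A, Set.mem_iUnion, Set.mem_inter_iff, Set.mem_preimage, Set.mem_singleton_iff]
    refine ⟨fun ⟨_, hx, _⟩ => hx, fun hx => ⟨e ⟨ψ x, ψ.mem_range_self x⟩, hx, by simp⟩⟩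
  have key : ∀ᵐ ω ∂P, ∏ᶠ i, (if T i ω ∈ D then ψ (T i ω) else 1)
      = ∏ a : Fin m, (e.symm a : ℂ) ^ (arrivalCount T (A a) ω).toNat := by
    filter_upwards [h.ae_finite hD hD0 hDv] with ω hfin
    rw [finprod_ite_eq_prod hfin]
    rw [← Finset.prod_fiberwise_of_maps_to (s := hfin.toFinset) (t := Finset.univ)
      (g := fun i => e ⟨ψ (T i ω), ψ.mem_range_self _⟩) (fun _ _ => Finset.mem_univ _)]
    refine Finset.prod_congr rfl fun a _ => ?_
    rw [Finset.prod_congr rfl (g := fun _ => (e.symm a : ℂ))]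
    · rw [Finset.prod_const]
      congr 1
      rw [arrivalCount, ← Set.ncard_def, ← Set.ncard_coe_finset]
      congr 1
      ext i
      simp only [A, Finset.coe_filter, Set.Finite.mem_toFinset, Set.mem_ofPred_eq,
        Set.mem_inter_iff, Set.mem_preimage, Set.mem_singleton_iff]
      refine and_congr_right fun _ => ?_
      rw [← e.eq_symm_apply, Subtype.ext_iff]
    · intro i hi
      rw [Finset.mem_filter] at hi
      rw [← hi.2]; simp
  rw [integral_congr_ae key]
  have hlaw := fun a => h.hasLaw_count (A a) (hA a) (hA0 a) (hAv a)
  have hind := h.indep_count m A hA hA0 hAv hdisj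
  rw [hind.integral_fun_prod_comp (f := fun a (n : ℕ∞) => (e.symm a : ℂ) ^ n.toNat)
    (fun a => (hlaw a).aemeasurable) (fun a => Measurable.of_discrete.aestronglyMeasurable)]
  have hone : ∀ a : Fin m, ∫ ω, (e.symm a : ℂ) ^ (arrivalCount T (A a) ω).toNat ∂P
      = Complex.exp (-(lam * ((volume.real (A a) : ℝ) * (1 - (e.symm a : ℂ))))) := by
    intro a
    have := (hlaw a).integral_comp (f := fun n : ℕ∞ => (e.symm a : ℂ) ^ n.toNat)
      (Measurable.of_discrete.aestronglyMeasurable)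
    rw [show (fun ω => (e.symm a : ℂ) ^ (arrivalCount T (A a) ω).toNat)
      = (fun n : ℕ∞ => (e.symm a : ℂ) ^ n.toNat) ∘ arrivalCount T (A a) from rfl, this,
      integral_map (by fun_prop) (Measurable.of_discrete.aestronglyMeasurable)]
    simp only [ENat.toNat_natCast]
    rw [integral_pow_poissonMeasure]
    congr 2
    rw [← mul_assoc]
    congr 1
    simp [Measure.real, ENNReal.toReal]
  rw [Finset.prod_congr rfl fun a _ => hone a, ← Complex.exp_sum, Finset.sum_neg_distrib,
    ← Finset.mul_sum]
  congr 3
  conv_rhs => rw [← hUn]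
  have hint : IntegrableOn (fun u => 1 - ψ u) D := by
    have : IsFiniteMeasure (volume.restrict D) := ⟨by simpa using hDv.lt_top⟩
    refine Integrable.of_bound (C := 2) ?_ (ae_of_all _ fun u => ?_)
    · exact (measurable_const.sub ψ.measurable).aestronglyMeasurable
    · calc ‖1 - ψ u‖ ≤ ‖(1 : ℂ)‖ + ‖ψ u‖ := norm_sub_le _ _
        _ ≤ 2 := by have := hψ u; norm_num; linarith
  rw [integral_iUnion_fintype hA hdisj (fun a => hint.mono_set Set.inter_subset_left)]
  refine Finset.sum_congr rfl fun a _ => ?_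
  rw [setIntegral_congr_fun (g := fun _ => 1 - (e.symm a : ℂ)) (hA a), setIntegral_const,
    Complex.real_smul]
  rintro x ⟨_, hx⟩
  simp only [Set.mem_preimage, Set.mem_singleton_iff] at hx
  simp [hx]

open Classical in
-- Approximation by simple functions and dominated convergence extend the formula to measurable `f`.
-- It is phrased through the first `n` arrivals because the independence arguments for batches and
-- routes treat finite products; almost surely these products are eventually constant in `n`.
lemma IsPoissonProcess.tendsto_integral_prod (h : IsPoissonProcess P lam T)
    [IsProbabilityMeasure P] {D : Set ℝ}
    (hD : MeasurableSet D) (hD0 : D ⊆ Set.Ici 0) (hDv : volume D ≠ ∞)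
    {f : ℝ → ℂ} (hf : Measurable f) (hf1 : ∀ x, ‖f x‖ ≤ 1) :
    Tendsto (fun n => ∫ ω, ∏ i ∈ Finset.range n, (if T i ω ∈ D then f (T i ω) else 1) ∂P) atTop
      (𝓝 (Complex.exp (-(lam * ∫ u in D, (1 - f u))))) := by
  have hmeas : ∀ g : ℝ → ℂ, Measurable g → ∀ n, Measurable fun ω =>
      ∏ i ∈ Finset.range n, (if T i ω ∈ D then g (T i ω) else 1) := by
    intro g hg n
    refine Finset.measurable_prod _ fun i _ => ?_
    exact Measurable.ite (h.measurable i hD) (hg.comp (h.measurable i)) measurable_const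
  have hbd : ∀ g : ℝ → ℂ, (∀ x, ‖g x‖ ≤ 1) → ∀ n ω,
      ‖∏ i ∈ Finset.range n, (if T i ω ∈ D then g (T i ω) else 1)‖ ≤ 1 := by
    intro g hg n ω
    refine norm_prod_le_one _ _ fun i _ => ?_
    split_ifs
    · exact hg _
    · simp
  have hlim : ∀ g : ℝ → ℂ, ∀ᵐ ω ∂P,
      Tendsto (fun n => ∏ i ∈ Finset.range n, (if T i ω ∈ D then g (T i ω) else 1)) atTop
      (𝓝 (∏ᶠ i, (if T i ω ∈ D then g (T i ω) else 1))) := by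
    intro g
    filter_upwards [h.ae_finite hD hD0 hDv] with ω hfin
    rw [finprod_ite_eq_prod hfin]
    exact tendsto_prod_range_finprod hfin (fun i => g (T i ω))
  have hpart : ∀ g : ℝ → ℂ, Measurable g → (∀ x, ‖g x‖ ≤ 1) →
      Tendsto (fun n => ∫ ω, ∏ i ∈ Finset.range n, (if T i ω ∈ D then g (T i ω) else 1) ∂P) atTop
      (𝓝 (∫ ω, ∏ᶠ i, (if T i ω ∈ D then g (T i ω) else 1) ∂P)) := by
    intro g hg hg1
    refine tendsto_integral_of_dominated_convergence (fun _ => 1)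
      (fun n => (hmeas g hg n).aestronglyMeasurable) (integrable_const _)
      (fun n => ae_of_all _ (hbd g hg1 n)) (hlim g)
  -- Approximating inside the closed unit disc keeps all products bounded by `1`.
  let ψ : ℕ → SimpleFunc ℝ ℂ := fun n =>
    SimpleFunc.approxOn f hf (Metric.closedBall (0 : ℂ) 1) 0 (by simp) n
  have hψ1 : ∀ n x, ‖ψ n x‖ ≤ 1 := fun n x => by
    simpa using SimpleFunc.approxOn_mem hf (s := Metric.closedBall (0 : ℂ) 1) (by simp) n x
  have hψf : ∀ x, Tendsto (fun n => ψ n x) atTop (𝓝 (f x)) := fun x =>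
    SimpleFunc.tendsto_approxOn hf _ (subset_closure (by simpa using hf1 x))
  have hlimψ : Tendsto (fun n => ∫ ω, ∏ᶠ i, (if T i ω ∈ D then ψ n (T i ω) else 1) ∂P) atTop
      (𝓝 (∫ ω, ∏ᶠ i, (if T i ω ∈ D then f (T i ω) else 1) ∂P)) := by
    refine tendsto_integral_of_dominated_convergence (fun _ => 1) (fun n => ?_)
      (integrable_const _) (fun n => ?_) ?_
    · exact aestronglyMeasurable_of_tendsto_ae atTop
        (fun k => (hmeas (ψ n) (ψ n).measurable k).aestronglyMeasurable) (hlim (ψ n))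
    · filter_upwards [h.ae_finite hD hD0 hDv] with ω hfin
      rw [finprod_ite_eq_prod hfin]
      exact norm_prod_le_one _ _ fun i _ => hψ1 n _
    · filter_upwards [h.ae_finite hD hD0 hDv] with ω hfin
      rw [finprod_ite_eq_prod hfin]
      simp_rw [finprod_ite_eq_prod hfin]
      exact tendsto_finsetProd _ fun i _ => hψf _
  have hexp : Tendsto (fun n => Complex.exp (-(lam * ∫ u in D, (1 - ψ n u)))) atTop
      (𝓝 (Complex.exp (-(lam * ∫ u in D, (1 - f u))))) := by
    refine (Complex.continuous_exp.tendsto _).comp (Tendsto.neg (Tendsto.const_mul _ ?_))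
    have : IsFiniteMeasure (volume.restrict D) := ⟨by simpa using hDv.lt_top⟩
    refine tendsto_integral_of_dominated_convergence (fun _ => 2) (fun n => ?_)
      (integrable_const _) (fun n => ae_of_all _ fun u => ?_)
      (ae_of_all _ fun u => tendsto_const_nhds.sub (hψf u))
    · exact (measurable_const.sub (ψ n).measurable).aestronglyMeasurable
    · calc ‖1 - ψ n u‖ ≤ ‖(1 : ℂ)‖ + ‖ψ n u‖ := norm_sub_le _ _
        _ ≤ 2 := by have := hψ1 n u; norm_num; linarith
  have heq := tendsto_nhds_unique hlimψ (hexp.congr fun n =>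
    (h.integral_finprod_simpleFunc hD hD0 hDv (ψ n) (hψ1 n)).symm)
  rw [← heq]
  exact hpart f hf hf1

end BatchNetwork

/-! ### Integrating out the routes and the batch sizes -/

namespace BatchNetwork

lemma integral_prod_eq_prod_integral_of_iIndep {Ω ι : Type*} {m : ι → MeasurableSpace Ω}
    {mΩ : MeasurableSpace Ω} {P : Measure Ω} (hm : ∀ i, m i ≤ mΩ) (h : iIndep m P)
    {f : ι → Ω → ℂ} (hf : ∀ i, Measurable[m i] (f i)) (s : Finset ι) :
    ∫ ω, ∏ i ∈ s, f i ω ∂P = ∏ i ∈ s, ∫ ω, f i ω ∂P := by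
  have hind : iIndepFun f P := by
    rw [iIndepFun_iff_iIndep]
    exact iIndep_of_iIndep_of_le h fun i => (hf i).comap_le
  have h1 := (hind.precomp (g := ((↑) : s → ι)) Subtype.val_injective).integral_fun_prod_eq_prod_integral
    (fun i => ((hf i).mono (hm i) le_rfl).aestronglyMeasurable)
  rw [← Finset.prod_coe_sort s fun i => ∫ ω, f i ω ∂P, ← h1]
  congr 1
  ext ω
  exact (Finset.prod_coe_sort s fun i => f i ω).symm

open Classical in
/-- The weight `z k` of the queue in which the customer with route `X` is at time `p.1`, and `1` if
it is in none of the queues. -/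
noncomputable def custWeight {Ω : Type*} {J : ℕ} (z : Fin J → ℂ) (X : ℝ → Ω → Option (Fin J))
    (p : ℝ × Ω) : ℂ := ∏ k, if 0 ≤ p.1 ∧ X p.1 p.2 = some k then z k else 1

/-- The product of the weights of the customers of a batch of size `y.2` at age `y.1`. -/
noncomputable def batchWeight {Ω : Type*} {J : ℕ} (z : Fin J → ℂ)
    (X : Fin J → ℕ → ℝ → Ω → Option (Fin J)) (y : ℝ × (Fin J → ℕ)) (ω : Ω) : ℂ :=
  ∏ j, ∏ l ∈ Finset.range (y.2 j), custWeight z (X j l) (y.1, ω)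

/-- The mean weight at age `τ` of a customer who entered at queue `j`. -/
noncomputable def meanWeight {J : ℕ} (q : Fin J → Fin J → ℝ → ℝ) (z : Fin J → ℂ) (j : Fin J)
    (τ : ℝ) : ℂ := 1 - ∑ k, (1 - z k) * ((if 0 ≤ τ then q j k τ else 0 : ℝ) : ℂ)

/-- The probability generating function of the batch size, with complex arguments. -/
noncomputable def complexPGF {J : ℕ} (ν : PMF (Fin J → ℕ)) (w : Fin J → ℂ) : ℂ :=
  ∑' n : Fin J → ℕ, ((ν n).toReal : ℂ) * ∏ j, w j ^ n j

section Weights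

variable {Ω : Type*} {J : ℕ} {z : Fin J → ℂ}

open Classical in
-- A customer is in at most one queue, so at most one factor differs from `1`. The affine form lets
-- the mean be computed queue by queue.
lemma custWeight_eq (z : Fin J → ℂ) (X : ℝ → Ω → Option (Fin J)) (p : ℝ × Ω) :
    custWeight z X p
      = 1 - ∑ k, (1 - z k) * (if 0 ≤ p.1 ∧ X p.1 p.2 = some k then 1 else 0) := by
  rw [custWeight]
  by_cases h : ∃ k, 0 ≤ p.1 ∧ X p.1 p.2 = some k
  · obtain ⟨k, h0, hk⟩ := h
    have : ∀ k', (0 ≤ p.1 ∧ X p.1 p.2 = some k') ↔ k = k' := fun k' => by simp [h0, hk]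
    simp [this]
  · push Not at h
    have : ∀ k', ¬ (0 ≤ p.1 ∧ X p.1 p.2 = some k') := fun k' h' => h k' h'.1 h'.2
    simp [this]

lemma norm_custWeight_le (hz : ∀ k, ‖z k‖ ≤ 1) (X : ℝ → Ω → Option (Fin J)) (p : ℝ × Ω) :
    ‖custWeight z X p‖ ≤ 1 := by
  refine norm_prod_le_one _ _ fun k _ => ?_
  split_ifs
  · exact hz k
  · simp

lemma norm_batchWeight_le (hz : ∀ k, ‖z k‖ ≤ 1) (X : Fin J → ℕ → ℝ → Ω → Option (Fin J))
    (y : ℝ × (Fin J → ℕ)) (ω : Ω) : ‖batchWeight z X y ω‖ ≤ 1 :=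
  norm_prod_le_one _ _ fun _ _ => norm_prod_le_one _ _ fun _ _ => norm_custWeight_le hz _ _

lemma measurable_custWeight [MeasurableSpace Ω] {X : ℝ → Ω → Option (Fin J)}
    (hX : ∀ k, MeasurableSet {p : ℝ × Ω | 0 ≤ p.1 ∧ X p.1 p.2 = some k}) (z : Fin J → ℂ) :
    Measurable (custWeight z X) :=
  Finset.measurable_prod _ fun k _ => Measurable.ite (hX k) measurable_const measurable_const

lemma measurable_prod_batchWeight [MeasurableSpace Ω] {X : ℕ → Fin J → ℕ → ℝ → Ω → Option (Fin J)}
    (hX : ∀ i j l k, MeasurableSet {p : ℝ × Ω | 0 ≤ p.1 ∧ X i j l p.1 p.2 = some k})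
    (z : Fin J → ℂ) (I : Finset ℕ) :
    Measurable fun p : (ℕ → ℝ × (Fin J → ℕ)) × Ω => ∏ i ∈ I, batchWeight z (X i) (p.1 i) p.2 := by
  refine Finset.measurable_prod _ fun i _ => Finset.measurable_prod _ fun j _ => ?_
  -- The number of factors is itself variable; it is made a separate countable coordinate and fixed,
  -- then substituted back.
  have h : Measurable fun r : ((ℕ → ℝ × (Fin J → ℕ)) × Ω) × ℕ =>
      ∏ l ∈ Finset.range r.2, custWeight z (X i j l) ((r.1.1 i).1, r.1.2) := by
    refine measurable_from_prod_countable_left fun n => ?_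
    refine Finset.measurable_prod (Finset.range n) fun l _ => ?_
    exact (measurable_custWeight (hX i j l) z).comp
      (g := custWeight z (X i j l))
      (f := fun p : (ℕ → ℝ × (Fin J → ℕ)) × Ω => ((p.1 i).1, p.2)) (by fun_prop)
  exact h.comp (f := fun p : (ℕ → ℝ × (Fin J → ℕ)) × Ω => (p, (p.1 i).2 j)) (by fun_prop)

open Classical in
lemma measurable_pair_ite [MeasurableSpace Ω] {T : ℕ → Ω → ℝ} {S : ℕ → Ω → Fin J → ℕ}
    (hT : ∀ i, Measurable (T i)) (hS : ∀ i, Measurable (S i)) {D : Set ℝ} (hD : MeasurableSet D)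
    (t : ℝ) : Measurable fun ω (i : ℕ) => (t - T i ω, if T i ω ∈ D then S i ω else 0) := by
  refine measurable_pi_lambda _ fun i => (measurable_const.sub (hT i)).prodMk ?_
  exact Measurable.ite (hT i hD) (hS i) measurable_const

lemma measurable_const_pair [MeasurableSpace Ω] {S : ℕ → Ω → Fin J → ℕ}
    (hS : ∀ i, Measurable (S i)) (τ : ℝ) : Measurable fun ω (i : ℕ) => (τ, S i ω) :=
  measurable_pi_lambda _ fun i => measurable_const.prodMk (hS i)

open Classical in
lemma measurable_prod_ite_pow [MeasurableSpace Ω] {S : ℕ → Ω → Fin J → ℕ}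
    (hS : ∀ i, Measurable (S i)) {f : Fin J → ℝ → ℂ} (hf : ∀ j, Measurable (f j)) {D : Set ℝ}
    (hD : MeasurableSet D) (t : ℝ) (I : Finset ℕ) :
    Measurable fun p : (ℕ → ℝ) × Ω => ∏ i ∈ I,
      (if p.1 i ∈ D then ∏ j, f j (t - p.1 i) ^ S i p.2 j else 1) := by
  refine Finset.measurable_prod _ fun i _ => ?_
  have hi : Measurable fun p : (ℕ → ℝ) × Ω => p.1 i := by fun_prop
  refine Measurable.ite (hi hD) (Finset.measurable_prod _ fun j _ => ?_) measurable_const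
  have := measurable_pi_iff.1 (hS i) j
  exact ((hf j).comp (measurable_const.sub hi)).pow (this.comp measurable_snd)

lemma measurableSet_prod_mono {m m' : MeasurableSpace Ω} (hm : m ≤ m') {A : Set (ℝ × Ω)}
    (hA : MeasurableSet[(inferInstance : MeasurableSpace ℝ).prod m] A) :
    MeasurableSet[(inferInstance : MeasurableSpace ℝ).prod m'] A :=
  sup_le_sup le_rfl (MeasurableSpace.comap_mono hm) _ hA

/-- The σ-algebra generated by a set of sources of randomness. -/
@[reducible] def sourcesSigma (T : ℕ → Ω → ℝ) (S : ℕ → Ω → Fin J → ℕ)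
    (X : ℕ → Fin J → ℕ → ℝ → Ω → Option (Fin J)) (A : Set (Source J)) : MeasurableSpace Ω :=
  ⨆ s ∈ A, sourceSigma T S X s

lemma sourceSigma_le_sourcesSigma (T : ℕ → Ω → ℝ) (S : ℕ → Ω → Fin J → ℕ)
    (X : ℕ → Fin J → ℕ → ℝ → Ω → Option (Fin J)) {A : Set (Source J)} {s : Source J} (hs : s ∈ A) :
    sourceSigma T S X s ≤ sourcesSigma T S X A :=
  le_iSup₂ (f := fun s (_ : s ∈ A) => sourceSigma T S X s) s hs

lemma measurable_batch_sourcesSigma (T : ℕ → Ω → ℝ) (S : ℕ → Ω → Fin J → ℕ)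
    (X : ℕ → Fin J → ℕ → ℝ → Ω → Option (Fin J)) {A : Set (Source J)} {i : ℕ}
    (hs : Source.batch i ∈ A) : Measurable[sourcesSigma T S X A] (S i) :=
  (comap_measurable (S i)).mono (sourceSigma_le_sourcesSigma T S X hs) le_rfl

lemma measurable_arrival_sourcesSigma (T : ℕ → Ω → ℝ) (S : ℕ → Ω → Fin J → ℕ)
    (X : ℕ → Fin J → ℕ → ℝ → Ω → Option (Fin J)) {A : Set (Source J)}
    (hs : Source.arrivals ∈ A) (i : ℕ) : Measurable[sourcesSigma T S X A] (T i) :=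
  (comap_measurable (T i)).mono ((le_iSup (fun i => MeasurableSpace.comap (T i) _) i).trans
    (sourceSigma_le_sourcesSigma T S X hs)) le_rfl

lemma comap_pi_le_iSup {T : ℕ → Ω → ℝ} :
    MeasurableSpace.comap (fun ω i => T i ω) inferInstance
      ≤ ⨆ i, MeasurableSpace.comap (T i) inferInstance :=
  Measurable.comap_le (@measurable_pi_lambda _ _ _ (⨆ i, MeasurableSpace.comap (T i) inferInstance)
    _ _ fun i => (comap_measurable (T i)).mono
      (le_iSup (fun i => MeasurableSpace.comap (T i) inferInstance) i) le_rfl)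

end Weights

section Network

variable {Ω : Type*} [mΩ : MeasurableSpace Ω] {P : Measure Ω} {J : ℕ} {lam : ℝ≥0}
  {ν : PMF (Fin J → ℕ)} {q : Fin J → Fin J → ℝ → ℝ} {T : ℕ → Ω → ℝ} {S : ℕ → Ω → Fin J → ℕ}
  {X : ℕ → Fin J → ℕ → ℝ → Ω → Option (Fin J)} {z : Fin J → ℂ}

namespace IsNetwork

lemma sourceSigma_le (h : IsNetwork P lam ν q T S X) (s : Source J) :
    sourceSigma T S X s ≤ mΩ := by
  cases s with
  | arrivals => exact iSup_le fun i => (h.poisson.measurable i).comap_le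
  | batch i => exact (h.measurable_batch i).comap_le
  | customer i j l =>
    refine MeasurableSpace.generateFrom_le ?_
    rintro _ ⟨t, k, ht, rfl⟩
    exact h.measurableSet_route i j l t k ht

lemma measurableSet_route_prod (h : IsNetwork P lam ν q T S X) (i : ℕ) (j : Fin J) (l : ℕ)
    (k : Fin J) : MeasurableSet {p : ℝ × Ω | 0 ≤ p.1 ∧ X i j l p.1 p.2 = some k} :=
  measurableSet_prod_mono (h.sourceSigma_le (.customer i j l)) (h.measurable_route i j l k)

lemma integral_custWeight [IsProbabilityMeasure P] (h : IsNetwork P lam ν q T S X) (z : Fin J → ℂ)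
    (i : ℕ) (j : Fin J) (l : ℕ) (τ : ℝ) :
    ∫ ω, custWeight z (X i j l) (τ, ω) ∂P = meanWeight q z j τ := by
  classical
  have hms : ∀ k, MeasurableSet {ω | 0 ≤ τ ∧ X i j l τ ω = some k} := fun k =>
    measurable_prodMk_left (h.measurableSet_route_prod i j l k)
  have hint : ∀ k, ∫ ω, (if 0 ≤ τ ∧ X i j l τ ω = some k then (1 : ℂ) else 0) ∂P
      = ((if 0 ≤ τ then q j k τ else 0 : ℝ) : ℂ) := by
    intro k
    have : (fun ω => (if 0 ≤ τ ∧ X i j l τ ω = some k then (1 : ℂ) else 0))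
        = Set.indicator {ω | 0 ≤ τ ∧ X i j l τ ω = some k} fun _ => 1 := by
      ext ω; simp [Set.indicator_apply]
    rw [this, integral_indicator_const _ (hms k)]
    split_ifs with h0
    · rw [← h.route_law i j l k τ h0]; simp [h0]
    · simp [h0]
  have hi : ∀ k, Integrable
      (fun ω => (1 - z k) * (if 0 ≤ τ ∧ X i j l τ ω = some k then (1 : ℂ) else 0)) P := by
    intro k
    refine Integrable.const_mul ?_ _
    refine Integrable.of_bound (C := 1) ?_ (ae_of_all _ fun ω => by split_ifs <;> simp)
    exact (Measurable.ite (hms k) measurable_const measurable_const).aestronglyMeasurable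
  simp_rw [custWeight_eq]
  rw [integral_sub (integrable_const _) (integrable_finsetSum _ fun k _ => hi k),
    integral_finsetSum _ fun k _ => hi k]
  simp_rw [integral_const_mul, hint]
  simp [meanWeight]

/-- No measurability of `q` is assumed: it is inherited from the joint measurability of a route by
integrating out `ω`. -/
lemma measurable_meanWeight [IsProbabilityMeasure P] (h : IsNetwork P lam ν q T S X)
    (z : Fin J → ℂ) (j : Fin J) : Measurable (meanWeight q z j) := by
  have := (measurable_custWeight (h.measurableSet_route_prod 0 j 0) z).stronglyMeasurable
  have h2 := this.integral_prod_right' (ν := P)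
  simp_rw [h.integral_custWeight] at h2
  exact h2.measurable

lemma norm_meanWeight_le [IsProbabilityMeasure P] (h : IsNetwork P lam ν q T S X)
    (hz : ∀ k, ‖z k‖ ≤ 1) (j : Fin J) (τ : ℝ) : ‖meanWeight q z j τ‖ ≤ 1 := by
  rw [← h.integral_custWeight z 0 j 0 τ]
  refine (norm_integral_le_of_norm_le_const (C := 1)
    (ae_of_all _ fun ω => norm_custWeight_le hz _ _)).trans ?_
  simp

lemma map_batch (h : IsNetwork P lam ν q T S X) (i : ℕ) : P.map (S i) = ν.toMeasure := by
  refine Measure.ext_of_singleton fun n => ?_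
  rw [Measure.map_apply (h.measurable_batch i) (measurableSet_singleton n),
    PMF.toMeasure_apply_singleton _ _ (measurableSet_singleton n), ← h.batch_law i n]
  rfl

lemma integral_prod_pow_batch (h : IsNetwork P lam ν q T S X)
    (i : ℕ) {w : Fin J → ℂ} (hw : ∀ j, ‖w j‖ ≤ 1) :
    ∫ ω, ∏ j, w j ^ S i ω j ∂P = complexPGF ν w := by
  have hm : Measurable fun n : Fin J → ℕ => ∏ j, w j ^ n j := Measurable.of_discrete
  rw [← integral_map (f := fun n : Fin J → ℕ => ∏ j, w j ^ n j) (h.measurable_batch i).aemeasurable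
    hm.aestronglyMeasurable, h.map_batch, PMF.integral_eq_tsum, complexPGF]
  · simp [Complex.real_smul]
  · refine Integrable.of_bound (C := 1) hm.aestronglyMeasurable (ae_of_all _ fun n => ?_)
    exact norm_prod_le_one _ _ fun j _ => by
      rw [norm_pow]; exact pow_le_one₀ (norm_nonneg _) (hw j)

lemma integral_prod_batchWeight_const [IsProbabilityMeasure P] (h : IsNetwork P lam ν q T S X)
    (z : Fin J → ℂ) (I : Finset ℕ) (y : ℕ → ℝ × (Fin J → ℕ)) :
    ∫ ω, ∏ i ∈ I, batchWeight z (X i) (y i) ω ∂P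
      = ∏ i ∈ I, ∏ j, meanWeight q z j (y i).1 ^ (y i).2 j := by
  let g : (Σ _ : ℕ, Σ _ : Fin J, ℕ) → Source J := fun c => .customer c.1 c.2.1 c.2.2
  have hg : Function.Injective g := by
    rintro ⟨i, j, l⟩ ⟨i', j', l'⟩ hc
    simp only [g, Source.customer.injEq] at hc
    obtain ⟨rfl, rfl, rfl⟩ := hc
    rfl
  -- Joint measurability relative to the route's own σ-algebra is needed here, so that weights of
  -- distinct customers are independent.
  have hmeas : ∀ c, Measurable[(sourceSigma T S X ∘ g) c]
      fun ω => custWeight z (X c.1 c.2.1 c.2.2) ((y c.1).1, ω) := by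
    intro c
    exact (@measurable_custWeight Ω J (routeSigma (X c.1 c.2.1 c.2.2)) _
      (h.measurable_route c.1 c.2.1 c.2.2) z).comp
        (@measurable_prodMk_left _ _ _ (routeSigma (X c.1 c.2.1 c.2.2)) _)
  have := integral_prod_eq_prod_integral_of_iIndep (fun c => h.sourceSigma_le (g c))
    (h.indep.precomp hg) hmeas
    (I.sigma fun i => Finset.univ.sigma fun j => Finset.range ((y i).2 j))
  simp only [Finset.prod_sigma, h.integral_custWeight] at this
  simpa [batchWeight] using this

/-- Integrating out the routes of the customers. -/
lemma integral_prod_batchWeight [IsProbabilityMeasure P] (h : IsNetwork P lam ν q T S X)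
    (hz : ∀ k, ‖z k‖ ≤ 1) (I : Finset ℕ) {Y : Ω → ℕ → ℝ × (Fin J → ℕ)} (hY : Measurable Y)
    (hYm : Measurable[sourcesSigma T S X {s | ∀ i j l, s ≠ .customer i j l}] Y) :
    ∫ ω, ∏ i ∈ I, batchWeight z (X i) (Y ω i) ω ∂P
      = ∫ ω, ∏ i ∈ I, ∏ j, meanWeight q z j (Y ω i).1 ^ (Y ω i).2 j ∂P := by
  have hm : sourcesSigma T S X {s | ∃ i j l, s = .customer i j l} ≤ mΩ :=
    iSup₂_le fun s _ => h.sourceSigma_le s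
  -- `Y` is a function of the arrivals and batch sizes, which are sources disjoint from the routes,
  -- so it can be frozen.
  have hind : Indep (MeasurableSpace.comap Y inferInstance)
      (sourcesSigma T S X {s | ∃ i j l, s = .customer i j l}) P := by
    refine indep_of_indep_of_le_left (indep_iSup_of_disjoint h.sourceSigma_le h.indep ?_)
      hYm.comap_le
    rw [Set.disjoint_left]
    rintro s hs ⟨i, j, l, hs'⟩
    exact hs i j l hs'
  rw [integral_eq_integral_integral_of_indep hm hY hind
    (@measurable_prod_batchWeight Ω J (sourcesSigma T S X {s | ∃ i j l, s = .customer i j l}) X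
      (fun i j l k => measurableSet_prod_mono
        (sourceSigma_le_sourcesSigma T S X (A := {s | ∃ i j l, s = .customer i j l})
          (s := .customer i j l) ⟨i, j, l, rfl⟩)
        (h.measurable_route i j l k)) z I)
    (fun p => norm_prod_le_one _ _ fun i _ => norm_batchWeight_le hz _ _ _)]
  simp_rw [h.integral_prod_batchWeight_const]

lemma integral_batchWeight [IsProbabilityMeasure P] (h : IsNetwork P lam ν q T S X)
    (hz : ∀ k, ‖z k‖ ≤ 1) (i : ℕ) (τ : ℝ) :
    ∫ ω, batchWeight z (X i) (τ, S i ω) ω ∂P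
      = complexPGF ν fun j => meanWeight q z j τ := by
  have := h.integral_prod_batchWeight hz {i} (measurable_const_pair h.measurable_batch τ)
    (@measurable_const_pair Ω J (sourcesSigma T S X {s | ∀ i j l, s ≠ .customer i j l}) S
      (fun i => measurable_batch_sourcesSigma T S X (by simp)) τ)
  simp only [Finset.prod_singleton] at this
  rw [this, h.integral_prod_pow_batch i fun j => h.norm_meanWeight_le hz j τ]

lemma norm_complexPGF_meanWeight_le [IsProbabilityMeasure P] (h : IsNetwork P lam ν q T S X)
    (hz : ∀ k, ‖z k‖ ≤ 1) (τ : ℝ) : ‖complexPGF ν fun j => meanWeight q z j τ‖ ≤ 1 := by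
  rw [← h.integral_batchWeight hz 0 τ]
  refine (norm_integral_le_of_norm_le_const (C := 1)
    (ae_of_all _ fun ω => norm_batchWeight_le hz _ _ _)).trans ?_
  simp

lemma measurable_complexPGF_meanWeight [IsProbabilityMeasure P] (h : IsNetwork P lam ν q T S X)
    (hz : ∀ k, ‖z k‖ ≤ 1) : Measurable fun τ => complexPGF ν fun j => meanWeight q z j τ := by
  have h1 : Measurable fun p : ℝ × Ω => ∏ j, meanWeight q z j p.1 ^ S 0 p.2 j := by
    refine Finset.measurable_prod _ fun j _ => ?_
    have := measurable_pi_iff.1 (h.measurable_batch 0) j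
    exact ((h.measurable_meanWeight z j).comp measurable_fst).pow (this.comp measurable_snd)
  have h2 := h1.stronglyMeasurable.integral_prod_right' (ν := P)
  simp_rw [fun τ => h.integral_prod_pow_batch 0 fun j => h.norm_meanWeight_le hz j τ] at h2
  exact h2.measurable

open Classical in
/-- Integrating out the routes and the sizes of the batches. -/
lemma integral_prod_range_batchWeight [IsProbabilityMeasure P] (h : IsNetwork P lam ν q T S X)
    (hz : ∀ k, ‖z k‖ ≤ 1) {D : Set ℝ} (hD : MeasurableSet D) (t : ℝ) (n : ℕ) :
    ∫ ω, ∏ i ∈ Finset.range n,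
        (if T i ω ∈ D then batchWeight z (X i) (t - T i ω, S i ω) ω else 1) ∂P
      = ∫ ω, ∏ i ∈ Finset.range n,
        (if T i ω ∈ D then complexPGF ν fun j => meanWeight q z j (t - T i ω) else 1) ∂P := by
  have h1 := h.integral_prod_batchWeight hz (Finset.range n)
    (measurable_pair_ite h.poisson.measurable h.measurable_batch hD t)
    (@measurable_pair_ite Ω J (sourcesSigma T S X {s | ∀ i j l, s ≠ .customer i j l}) T S
      (fun i => measurable_arrival_sourcesSigma T S X (by simp) i)
      (fun i => measurable_batch_sourcesSigma T S X (by simp)) D hD t)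
  -- An empty batch has weight `1`, so setting the size to `0` encodes the restriction to arrivals
  -- in `D`.
  have e1 : ∀ ω, ∏ i ∈ Finset.range n,
      batchWeight z (X i) (t - T i ω, if T i ω ∈ D then S i ω else 0) ω
      = ∏ i ∈ Finset.range n,
      (if T i ω ∈ D then batchWeight z (X i) (t - T i ω, S i ω) ω else 1) := by
    intro ω
    refine Finset.prod_congr rfl fun i _ => ?_
    split_ifs <;> simp [batchWeight]
  have e2 : ∀ ω, ∏ i ∈ Finset.range n, ∏ j,
      meanWeight q z j (t - T i ω) ^ (if T i ω ∈ D then S i ω else 0) j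
      = ∏ i ∈ Finset.range n,
      (if T i ω ∈ D then ∏ j, meanWeight q z j (t - T i ω) ^ S i ω j else 1) := by
    intro ω
    refine Finset.prod_congr rfl fun i _ => ?_
    split_ifs <;> simp
  simp_rw [e1, e2] at h1
  rw [h1]
  have hm : sourcesSigma T S X {s | ∃ i, s = .batch i} ≤ mΩ :=
    iSup₂_le fun s _ => h.sourceSigma_le s
  -- Second freezing: the arrival times are held fixed while the mutually independent batch sizes
  -- are averaged.
  have hind : Indep (MeasurableSpace.comap (fun ω i => T i ω) inferInstance)
      (sourcesSigma T S X {s | ∃ i, s = .batch i}) P := by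
    refine indep_of_indep_of_le_left (indep_iSup_of_disjoint h.sourceSigma_le h.indep
      (S := {Source.arrivals}) ?_) ?_
    · rw [Set.disjoint_left]
      rintro s rfl ⟨i, hs'⟩
      cases hs'
    · rw [iSup_singleton]
      exact comap_pi_le_iSup
  rw [integral_eq_integral_integral_of_indep hm
    (measurable_pi_lambda _ fun i => h.poisson.measurable i) hind
    (@measurable_prod_ite_pow Ω J (sourcesSigma T S X {s | ∃ i, s = .batch i}) S
      (fun i => measurable_batch_sourcesSigma T S X ⟨i, rfl⟩) _
      (fun j => h.measurable_meanWeight z j) D hD t (Finset.range n)) ?_]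
  · congr 1
    ext ω
    have := integral_prod_eq_prod_integral_of_iIndep
      (m := sourceSigma T S X ∘ Source.batch) (fun i => h.sourceSigma_le (Source.batch i))
      (h.indep.precomp (g := Source.batch) fun i i' hi => by simpa using hi)
      (f := fun i ω' =>
        if T i ω ∈ D then ∏ j, meanWeight q z j (t - T i ω) ^ S i ω' j else 1)
      (fun i => ?_) (Finset.range n)
    · rw [this]
      refine Finset.prod_congr rfl fun i _ => ?_
      split_ifs
      · exact h.integral_prod_pow_batch i fun j => h.norm_meanWeight_le hz j _
      · simp
    · have hd : Measurable fun n : Fin J → ℕ =>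
          if T i ω ∈ D then ∏ j, meanWeight q z j (t - T i ω) ^ n j else 1 := .of_discrete
      exact hd.comp (comap_measurable (S i))
  · intro p
    refine norm_prod_le_one _ _ fun i _ => ?_
    split_ifs
    · refine norm_prod_le_one _ _ fun j _ => ?_
      rw [norm_pow]
      exact pow_le_one₀ (norm_nonneg _) (h.norm_meanWeight_le hz j _)
    · simp

end IsNetwork

end Network

end BatchNetwork

/-! ### Customer counts and their generating function -/

namespace BatchNetwork

/-- The number of customers in queue `k` at time `t` that arrived at a time in `D`. -/
noncomputable def occupancyFrom {Ω : Type*} {J : ℕ} (T : ℕ → Ω → ℝ) (S : ℕ → Ω → Fin J → ℕ)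
    (X : ℕ → Fin J → ℕ → ℝ → Ω → Option (Fin J)) (D : Set ℝ) (t : ℝ) (k : Fin J) (ω : Ω) : ℕ∞ :=
  {c : ℕ × Fin J × ℕ | T c.1 ω ∈ D ∧ c.2.2 < S c.1 ω c.2.1 ∧
    X c.1 c.2.1 c.2.2 (t - T c.1 ω) ω = some k}.encard

/-- The vector of the numbers of customers present at time `t` that arrived at a time in `D`. -/
noncomputable def countVec {Ω : Type*} {J : ℕ} (T : ℕ → Ω → ℝ) (S : ℕ → Ω → Fin J → ℕ)
    (X : ℕ → Fin J → ℕ → ℝ → Ω → Option (Fin J)) (D : Set ℝ) (t : ℝ) (ω : Ω) (k : Fin J) : ℕ :=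
  (occupancyFrom T S X D t k ω).toNat

section Pathwise

variable {Ω : Type*} {J : ℕ} {T : ℕ → Ω → ℝ} {S : ℕ → Ω → Fin J → ℕ}
  {X : ℕ → Fin J → ℕ → ℝ → Ω → Option (Fin J)} {z : Fin J → ℂ} {D : Set ℝ} {t : ℝ} {ω : Ω}

lemma occupancyFrom_eq_card (hfin : {i | T i ω ∈ D}.Finite) (k : Fin J) :
    occupancyFrom T S X D t k ω
      = (((hfin.toFinset.sigma fun i => Finset.univ.sigma fun j => Finset.range (S i ω j)).filter
        fun c : (Σ _ : ℕ, Σ _ : Fin J, ℕ) =>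
          X c.1 c.2.1 c.2.2 (t - T c.1 ω) ω = some k).card : ℕ∞) := by
  let e : (Σ _ : ℕ, Σ _ : Fin J, ℕ) → ℕ × Fin J × ℕ := fun c => (c.1, c.2.1, c.2.2)
  have he : Function.Injective e := by
    rintro ⟨i, j, l⟩ ⟨i', j', l'⟩ hc
    simp only [e, Prod.mk.injEq] at hc
    obtain ⟨rfl, rfl, rfl⟩ := hc
    rfl
  rw [← Set.encard_coe_eq_coe_finsetCard, ← he.encard_image, occupancyFrom]
  congr 1
  ext ⟨i, j, l⟩
  simp only [Set.mem_ofPred_eq, Finset.coe_filter, Finset.mem_sigma, Set.Finite.mem_toFinset,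
    Finset.mem_univ, Finset.mem_range, true_and, Set.mem_image, e, Prod.mk.injEq]
  constructor
  · rintro ⟨h1, h2, h3⟩
    exact ⟨⟨i, j, l⟩, ⟨⟨h1, h2⟩, h3⟩, rfl, rfl, rfl⟩
  · rintro ⟨⟨i', j', l'⟩, ⟨⟨h1, h2⟩, h3⟩, rfl, rfl, rfl⟩
    exact ⟨h1, h2, h3⟩

lemma occupancyFrom_ne_top (hfin : {i | T i ω ∈ D}.Finite) (k : Fin J) :
    occupancyFrom T S X D t k ω ≠ ⊤ := by
  rw [occupancyFrom_eq_card hfin]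
  exact ENat.natCast_ne_top _

/-- Collect the weights by queue instead of by customer. The inclusion `D ⊆ Iic t` makes all ages
nonnegative, so the age condition in `custWeight` is automatic. -/
lemma prod_batchWeight_eq_prod_pow (hfin : {i | T i ω ∈ D}.Finite) (hDt : D ⊆ Set.Iic t) :
    ∏ i ∈ hfin.toFinset, batchWeight z (X i) (t - T i ω, S i ω) ω
      = ∏ k, z k ^ countVec T S X D t ω k := by
  have h1 : ∀ k, countVec T S X D t ω k = _ := fun k => by
    rw [countVec, occupancyFrom_eq_card hfin, ENat.toNat_natCast]
  simp_rw [h1, batchWeight]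
  rw [Finset.prod_congr rfl fun i _ => (Finset.prod_sigma Finset.univ
      (fun j => Finset.range (S i ω j)) fun c => custWeight z (X i c.1 c.2) (t - T i ω, ω)).symm,
    ← Finset.prod_sigma hfin.toFinset
      (fun i => Finset.univ.sigma fun j => Finset.range (S i ω j))
      fun c => custWeight z (X c.1 c.2.1 c.2.2) (t - T c.1 ω, ω)]
  simp_rw [custWeight]
  rw [Finset.prod_comm]
  refine Finset.prod_congr rfl fun k _ => ?_
  rw [← Finset.prod_const, Finset.prod_filter]
  refine Finset.prod_congr rfl fun c hc => ?_
  have h0 : 0 ≤ t - T c.1 ω := by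
    simp only [Finset.mem_sigma, Set.Finite.mem_toFinset, Set.mem_ofPred_eq] at hc
    exact sub_nonneg.2 (hDt hc.1)
  simp [h0]

lemma countVec_union {D₁ D₂ : Set ℝ} (hd : Disjoint D₁ D₂) (h₁ : {i | T i ω ∈ D₁}.Finite)
    (h₂ : {i | T i ω ∈ D₂}.Finite) :
    countVec T S X (D₁ ∪ D₂) t ω = countVec T S X D₁ t ω + countVec T S X D₂ t ω := by
  ext k
  rw [Pi.add_apply, countVec, countVec, countVec,
    ← ENat.toNat_add (occupancyFrom_ne_top h₁ k) (occupancyFrom_ne_top h₂ k)]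
  congr 1
  rw [occupancyFrom, occupancyFrom, occupancyFrom, ← Set.encard_union_eq]
  · congr 1
    ext c
    simp only [Set.mem_union, Set.mem_ofPred_eq, or_and_right]
  · rw [Set.disjoint_left]
    rintro c ⟨hc, _⟩ ⟨hc', _⟩
    exact Set.disjoint_left.1 hd hc hc'

end Pathwise

section Network

variable {Ω : Type*} [mΩ : MeasurableSpace Ω] {P : Measure Ω} {J : ℕ} {lam : ℝ≥0}
  {ν : PMF (Fin J → ℕ)} {q : Fin J → Fin J → ℝ → ℝ} {T : ℕ → Ω → ℝ} {S : ℕ → Ω → Fin J → ℕ}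
  {X : ℕ → Fin J → ℕ → ℝ → Ω → Option (Fin J)} {z : Fin J → ℂ}

namespace IsNetwork

lemma measurable_occupancyFrom (h : IsNetwork P lam ν q T S X) {D : Set ℝ} (hD : MeasurableSet D)
    {t : ℝ} (hDt : D ⊆ Set.Iic t) (k : Fin J) : Measurable (occupancyFrom T S X D t k) := by
  classical
  have hset : ∀ c : ℕ × Fin J × ℕ, MeasurableSet {ω | T c.1 ω ∈ D ∧ c.2.2 < S c.1 ω c.2.1 ∧
      X c.1 c.2.1 c.2.2 (t - T c.1 ω) ω = some k} := by
    rintro ⟨i, j, l⟩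
    have h1 : MeasurableSet {ω | T i ω ∈ D} := h.poisson.measurable i hD
    have h2 : MeasurableSet {ω | l < S i ω j} :=
      measurableSet_lt measurable_const (measurable_pi_iff.1 (h.measurable_batch i) j)
    -- The route is read at a random age, which is where measurability in time and chance together
    -- is used.
    have hp : Measurable fun ω => (t - T i ω, ω) :=
      (measurable_const.sub (h.poisson.measurable i)).prodMk measurable_id
    have h3 := hp (h.measurableSet_route_prod i j l k)
    convert! h1.inter (h2.inter h3) using 1
    ext ω
    simp only [Set.mem_ofPred_eq, Set.mem_inter_iff, Set.mem_preimage, sub_nonneg]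
    refine and_congr_right fun hT => and_congr_right fun _ => ?_
    exact (and_iff_right (hDt hT)).symm
  -- The cardinality is a countable sum of measurable indicators.
  have hsum : Measurable fun ω => ∑' c : ℕ × Fin J × ℕ,
      Set.indicator {ω | T c.1 ω ∈ D ∧ c.2.2 < S c.1 ω c.2.1 ∧
        X c.1 c.2.1 c.2.2 (t - T c.1 ω) ω = some k} (fun _ => (1 : ℝ≥0∞)) ω :=
    Measurable.tsum fun c => measurable_const.indicator (hset c)
  have heq : ∀ ω, ∑' c : ℕ × Fin J × ℕ,
      Set.indicator {ω | T c.1 ω ∈ D ∧ c.2.2 < S c.1 ω c.2.1 ∧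
        X c.1 c.2.1 c.2.2 (t - T c.1 ω) ω = some k} (fun _ => (1 : ℝ≥0∞)) ω
      = (occupancyFrom T S X D t k ω : ℝ≥0∞) := by
    intro ω
    rw [occupancyFrom, ← ENNReal.tsum_set_one]
    refine Eq.trans ?_ (tsum_subtype _ fun _ => 1).symm
    exact tsum_congr fun c => by simp [Set.indicator_apply]
  simp_rw [heq] at hsum
  refine measurable_to_countable' fun n => ?_
  have := hsum (measurableSet_singleton (n : ℝ≥0∞))
  convert! this using 1
  ext ω
  simp

lemma measurable_countVec (h : IsNetwork P lam ν q T S X) {D : Set ℝ} (hD : MeasurableSet D)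
    {t : ℝ} (hDt : D ⊆ Set.Iic t) : Measurable (countVec T S X D t) :=
  measurable_pi_lambda _ fun k =>
    (Measurable.of_discrete (f := ENat.toNat)).comp (h.measurable_occupancyFrom hD hDt k)

/-- The generating function of the number of customers present at time `t` that arrived at a time
in `D`. -/
lemma integral_prod_pow_countVec [IsProbabilityMeasure P] (h : IsNetwork P lam ν q T S X)
    (hz : ∀ k, ‖z k‖ ≤ 1) {D : Set ℝ} (hD : MeasurableSet D) {t : ℝ} (hDt : D ⊆ Set.Icc 0 t) :
    ∫ ω, ∏ k, z k ^ countVec T S X D t ω k ∂P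
      = Complex.exp (-(lam * ∫ u in D, (1 - complexPGF ν fun j => meanWeight q z j (t - u)))) := by
  classical
  have hD0 : D ⊆ Set.Ici 0 := hDt.trans Set.Icc_subset_Ici_self
  have hDt' : D ⊆ Set.Iic t := hDt.trans Set.Icc_subset_Iic_self
  have hDv : volume D ≠ ∞ := measure_ne_top_of_subset hDt (by simp)
  have h1 := h.poisson.tendsto_integral_prod hD hD0 hDv
    (f := fun u => complexPGF ν fun j => meanWeight q z j (t - u))
    ((h.measurable_complexPGF_meanWeight hz).comp (measurable_const.sub measurable_id))
    (fun u => h.norm_complexPGF_meanWeight_le hz _)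
  simp_rw [← h.integral_prod_range_batchWeight hz hD t] at h1
  -- The same sequence of integrals also converges, by dominated convergence, to the generating
  -- function of the counts.
  refine tendsto_nhds_unique ?_ h1
  refine tendsto_integral_of_dominated_convergence (fun _ => 1) (fun n => ?_)
    (integrable_const _) (fun n => ae_of_all _ fun ω => ?_) ?_
  · have hm := (measurable_prod_batchWeight h.measurableSet_route_prod z (Finset.range n)).comp
      ((measurable_pair_ite h.poisson.measurable h.measurable_batch hD t).prodMk measurable_id)
    refine Measurable.aestronglyMeasurable ?_
    convert! hm using 1
    ext ω
    refine Finset.prod_congr rfl fun i _ => ?_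
    split_ifs with hi <;> simp [batchWeight, hi]
  · refine norm_prod_le_one _ _ fun i _ => ?_
    split_ifs
    · exact norm_batchWeight_le hz _ _ _
    · simp
  · filter_upwards [h.poisson.ae_finite hD hD0 hDv] with ω hfin
    rw [← prod_batchWeight_eq_prod_pow hfin hDt']
    exact tendsto_prod_range_finprod hfin fun i => batchWeight z (X i) (t - T i ω, S i ω) ω

lemma ae_countVec_union (h : IsNetwork P lam ν q T S X) {D₁ D₂ : Set ℝ} (h₁ : MeasurableSet D₁)
    (h₂ : MeasurableSet D₂) (hd : Disjoint D₁ D₂) {t : ℝ} (h₁t : D₁ ⊆ Set.Icc 0 t)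
    (h₂t : D₂ ⊆ Set.Icc 0 t) :
    ∀ᵐ ω ∂P, countVec T S X (D₁ ∪ D₂) t ω = countVec T S X D₁ t ω + countVec T S X D₂ t ω := by
  filter_upwards [h.poisson.ae_finite h₁ (h₁t.trans Set.Icc_subset_Ici_self)
      (measure_ne_top_of_subset h₁t (by simp)),
    h.poisson.ae_finite h₂ (h₂t.trans Set.Icc_subset_Ici_self)
      (measure_ne_top_of_subset h₂t (by simp))] with ω hf₁ hf₂
  exact countVec_union hd hf₁ hf₂

lemma measure_occupancy_eq (h : IsNetwork P lam ν q T S X) (t : ℝ) (n : Fin J → ℕ) :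
    P {ω | ∀ k, occupancy T S X t k ω = n k}
      = P.map (countVec T S X (Set.Icc 0 t) t) {n} := by
  rw [Measure.map_apply (h.measurable_countVec measurableSet_Icc Set.Icc_subset_Iic_self)
    (measurableSet_singleton n)]
  refine measure_congr ?_
  filter_upwards [h.poisson.nonneg, h.poisson.ae_finite (D := Set.Icc 0 t) measurableSet_Icc
    Set.Icc_subset_Ici_self (by simp)] with ω h0 hfin
  apply propext
  change (∀ k, occupancy T S X t k ω = n k) ↔ countVec T S X (Set.Icc 0 t) t ω = n
  rw [funext_iff]
  refine forall_congr' fun k => ?_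
  have : occupancy T S X t k ω = occupancyFrom T S X (Set.Icc 0 t) t k ω := by
    simp only [occupancy, occupancyFrom, Set.mem_Icc, h0, true_and]
  rw [this, countVec, ← ENat.toNat_natCast (n k)]
  constructor
  · intro hk
    rw [hk]
    simp
  · intro hk
    rw [← ENat.natCast_toNat (occupancyFrom_ne_top hfin k), hk]

end IsNetwork

end Network

/-- The law of an `ℕ^J`-valued random vector is determined by its generating function on the
unit torus. -/
lemma ext_of_integral_prod_pow {J : ℕ} {μ μ' : Measure (Fin J → ℕ)} [IsFiniteMeasure μ]
    [IsFiniteMeasure μ']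
    (h : ∀ z : Fin J → ℂ, (∀ k, ‖z k‖ ≤ 1) →
      ∫ n, ∏ k, z k ^ n k ∂μ = ∫ n, ∏ k, z k ^ n k ∂μ') : μ = μ' := by
  -- After embedding in Euclidean space, the generating function at `z_k = exp(i θ_k)` is the
  -- characteristic function at `θ`.
  let e : (Fin J → ℕ) → EuclideanSpace ℝ (Fin J) := fun n => WithLp.toLp 2 fun k => (n k : ℝ)
  have he : Measurable e := .of_discrete
  have hinj : Function.Injective e := by
    intro n n' hn
    ext k
    have := congrFun (congrArg (WithLp.ofLp) hn) k
    simpa [e] using this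
  have hmap : μ.map e = μ'.map e := by
    refine Measure.ext_of_charFun ?_
    ext θ
    rw [charFun_apply, charFun_apply, integral_map he.aemeasurable (by fun_prop),
      integral_map he.aemeasurable (by fun_prop)]
    have hexp : ∀ n : Fin J → ℕ, Complex.exp ((inner ℝ (e n) θ : ℝ) * Complex.I)
        = ∏ k, Complex.exp (θ k * Complex.I) ^ n k := by
      intro n
      simp_rw [← Complex.exp_nat_mul]
      rw [← Complex.exp_sum]
      congr 1
      simp only [e, PiLp.inner_apply]
      push_cast
      rw [Finset.sum_mul]
      refine Finset.sum_congr rfl fun k _ => ?_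
      simp
      ring
    simp_rw [hexp]
    exact h _ fun k => by rw [Complex.norm_exp_ofReal_mul_I]
  refine Measure.ext_of_singleton fun n => ?_
  have hn := congrArg (fun m => m {e n}) hmap
  simp only [Measure.map_apply he (measurableSet_singleton _)] at hn
  have : e ⁻¹' {e n} = {n} := by
    ext n'; simp [hinj.eq_iff]
  rwa [this] at hn

/-- A family of probability measures on a countable set that is Cauchy in total variation converges
pointwise to a probability distribution. -/
lemma exists_pmf_tendsto {E : Type*} [Countable E] [MeasurableSpace E] [DiscreteMeasurableSpace E]
    {μ : ℝ → Measure E} [∀ t, IsProbabilityMeasure (μ t)]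
    (h : ∀ ε > 0, ∃ s, ∀ t ≥ s, ∀ F : Set E, (μ s).real F - ε ≤ (μ t).real F) :
    ∃ p : PMF E, ∀ n, Tendsto (fun t => μ t {n}) atTop (𝓝 (p n)) := by
  -- The one-sided bound applied to `Fᶜ` gives the other side, since total masses are `1`.
  have habs : ∀ ε > 0, ∃ s, ∀ t ≥ s, ∀ F : Set E, |(μ t).real F - (μ s).real F| ≤ ε := by
    intro ε hε
    obtain ⟨s, hs⟩ := h ε hε
    refine ⟨s, fun t ht F => ?_⟩
    have h1 := hs t ht F
    have h2 := hs t ht Fᶜ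
    rw [probReal_compl_eq_one_sub (.of_discrete), probReal_compl_eq_one_sub (.of_discrete)] at h2
    rw [abs_le]
    constructor <;> linarith
  have hcauchy : ∀ n, ∃ x, Tendsto (fun t => (μ t).real {n}) atTop (𝓝 x) := by
    intro n
    refine cauchy_map_iff_exists_tendsto.1 ?_
    rw [Metric.cauchy_iff]
    refine ⟨inferInstance, fun ε hε => ?_⟩
    obtain ⟨s, hs⟩ := habs (ε / 3) (by positivity)
    refine ⟨_, image_mem_map (Ici_mem_atTop s), ?_⟩
    rintro _ ⟨t, ht, rfl⟩ _ ⟨t', ht', rfl⟩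
    have h1 := hs t ht {n}
    have h2 := hs t' ht' {n}
    rw [Real.dist_eq]
    rw [abs_le] at h1 h2
    rw [abs_lt]
    constructor <;> linarith
  choose p hp using hcauchy
  have hp0 : ∀ n, 0 ≤ p n := fun n => ge_of_tendsto' (hp n) fun t => measureReal_nonneg
  have hsum : ∀ F : Finset E, Tendsto (fun t => (μ t).real (F : Set E)) atTop
      (𝓝 (∑ n ∈ F, p n)) := by
    intro F
    simp_rw [← fun t => sum_measureReal_singleton (μ := μ t) F]
    exact tendsto_finsetSum _ fun n _ => hp n
  have hle : ∀ F : Finset E, ∑ n ∈ F, p n ≤ 1 := fun F =>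
    le_of_tendsto' (hsum F) fun t => measureReal_le_one
  -- No mass escapes: a finite set carrying more than `1 - ε/2` at time `s` carries at least `1 - ε`
  -- at all later times.
  have hhas : HasSum p 1 := by
    refine hasSum_of_isLUB_of_nonneg _ hp0 ⟨?_, ?_⟩
    · rintro _ ⟨F, rfl⟩
      exact hle F
    · intro b hb
      refine le_of_forall_pos_le_add fun ε hε => ?_
      obtain ⟨s, hs⟩ := h (ε / 2) (by positivity)
      have hμ : HasSum (fun n => (μ s).real {n}) 1 := by
        have h1 : ∑' n, μ s {n} = 1 := by
          have := (μ s).tsum_indicator_apply_singleton Set.univ .univ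
          simpa using this
        have h2 := ENNReal.hasSum_toReal (f := fun n => μ s {n}) (by rw [h1]; simp)
        rwa [← ENNReal.tsum_toReal_eq fun n => measure_ne_top _ _, h1, ENNReal.toReal_one] at h2
      have hev := hμ.eventually (lt_mem_nhds (show 1 - ε / 2 < 1 by linarith))
      obtain ⟨F, hF⟩ := hev.exists
      rw [sum_measureReal_singleton] at hF
      have h3 : 1 - ε ≤ ∑ n ∈ F, p n := by
        refine ge_of_tendsto (hsum F) ?_
        filter_upwards [eventually_ge_atTop s] with t ht
        have := hs t ht F
        linarith
      have := hb ⟨F, rfl⟩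
      simp only at this
      linarith
  refine ⟨⟨fun n => ENNReal.ofReal (p n), ?_⟩, fun n => ?_⟩
  · rw [ENNReal.summable.hasSum_iff, ← ENNReal.ofReal_tsum_of_nonneg hp0 hhas.summable,
      hhas.tsum_eq, ENNReal.ofReal_one]
  · exact (ENNReal.tendsto_ofReal (hp n)).congr fun t => by simp [measureReal_def]

end BatchNetwork

/-! ### The ergodicity criterion -/

namespace BatchNetwork

/-- `Q_j(τ)` for `τ ≥ 0`, and `0` for `τ < 0`. -/
noncomputable def stayProbExt {J : ℕ} (q : Fin J → Fin J → ℝ → ℝ) (j : Fin J) (τ : ℝ) : ℝ :=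
  if 0 ≤ τ then stayProb q j τ else 0

/-- The probability that not all customers of a batch survive at age `τ`, if every customer present
in the network is killed with probability `1 - s`. For `s = 0` it is the probability that at least
one customer of the batch is present. -/
noncomputable def killProb {J : ℕ} (ν : PMF (Fin J → ℕ)) (q : Fin J → Fin J → ℝ → ℝ) (s τ : ℝ) :
    ℝ := 1 - batchPGF ν fun j => 1 - (1 - s) * stayProbExt q j τ

lemma meanWeight_ofReal {J : ℕ} (q : Fin J → Fin J → ℝ → ℝ) (s : ℝ) (j : Fin J) (τ : ℝ) :
    meanWeight q (fun _ => (s : ℂ)) j τ = ((1 - (1 - s) * stayProbExt q j τ : ℝ) : ℂ) := by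
  rw [meanWeight, ← Finset.mul_sum, stayProbExt, stayProb]
  split_ifs <;> simp

lemma complexPGF_ofReal {J : ℕ} (ν : PMF (Fin J → ℕ)) (w : Fin J → ℝ) :
    complexPGF ν (fun j => (w j : ℂ)) = (batchPGF ν w : ℂ) := by
  rw [complexPGF, batchPGF, Complex.ofReal_tsum]
  simp

lemma complexPGF_meanWeight_ofReal {J : ℕ} (ν : PMF (Fin J → ℕ)) (q : Fin J → Fin J → ℝ → ℝ)
    (s τ : ℝ) :
    complexPGF ν (fun j => meanWeight q (fun _ => (s : ℂ)) j τ) = ((1 - killProb ν q s τ : ℝ) : ℂ) := by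
  simp_rw [meanWeight_ofReal]
  rw [complexPGF_ofReal, killProb, sub_sub_cancel]

/-- Factors are merged one at a time: `(1 + ab)/2 - (1 + a)/2 · (1 + b)/2 = (1 - a)(1 - b)/4 ≥ 0`
for `a, b ∈ [0, 1]`. -/
lemma prod_half_one_add_le {ι : Type*} (s : Finset ι) (y : ι → ℝ) (h0 : ∀ i, 0 ≤ y i)
    (h1 : ∀ i, y i ≤ 1) (n : ι → ℕ) :
    ∏ i ∈ s, ((1 + y i) / 2) ^ n i ≤ (1 + ∏ i ∈ s, y i ^ n i) / 2 := by
  have hmul : ∀ a b a' b' : ℝ, 0 ≤ a → a ≤ 1 → 0 ≤ b → b ≤ 1 → 0 ≤ b' → a' ≤ (1 + a) / 2 →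
      b' ≤ (1 + b) / 2 → a' * b' ≤ (1 + a * b) / 2 := by
    intro a b a' b' ha ha1 hb hb1 hb' haa hbb
    calc a' * b' ≤ (1 + a) / 2 * ((1 + b) / 2) := mul_le_mul haa hbb hb' (by linarith)
      _ ≤ (1 + a * b) / 2 := by nlinarith [mul_nonneg (sub_nonneg.2 ha1) (sub_nonneg.2 hb1)]
  have hpow : ∀ i m, ((1 + y i) / 2) ^ m ≤ (1 + y i ^ m) / 2 := by
    intro i m
    induction m with
    | zero => simp
    | succ m ih =>
      rw [pow_succ, pow_succ]
      exact hmul _ _ _ _ (pow_nonneg (h0 i) m) (pow_le_one₀ (h0 i) (h1 i)) (h0 i) (h1 i)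
        (by linarith [h0 i]) ih le_rfl
  classical
  induction s using Finset.induction_on with
  | empty => simp
  | insert i s his ih =>
    rw [Finset.prod_insert his, Finset.prod_insert his]
    refine hmul _ _ _ _ (pow_nonneg (h0 i) _) (pow_le_one₀ (h0 i) (h1 i))
      (Finset.prod_nonneg fun k _ => pow_nonneg (h0 k) _)
      (Finset.prod_le_one (fun k _ => pow_nonneg (h0 k) _) fun k _ => pow_le_one₀ (h0 k) (h1 k))
      (Finset.prod_nonneg fun k _ => pow_nonneg (by linarith [h0 k]) _) (hpow i _) ih

lemma hasSum_toReal_pmf {E : Type*} (p : PMF E) : HasSum (fun n => (p n).toReal) 1 := by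
  have h := ENNReal.hasSum_toReal (f := p) (by rw [p.tsum_coe]; simp)
  rwa [← ENNReal.tsum_toReal_eq p.apply_ne_top, p.tsum_coe, ENNReal.toReal_one] at h

lemma batchPGF_half_one_add_le {J : ℕ} (ν : PMF (Fin J → ℕ)) (y : Fin J → ℝ) (h0 : ∀ j, 0 ≤ y j)
    (h1 : ∀ j, y j ≤ 1) :
    batchPGF ν (fun j => (1 + y j) / 2) ≤ (1 + batchPGF ν y) / 2 := by
  have hν := hasSum_toReal_pmf ν
  have hsum : ∀ w : Fin J → ℝ, (∀ j, 0 ≤ w j) → (∀ j, w j ≤ 1) →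
      Summable fun n : Fin J → ℕ => (ν n).toReal * ∏ j, w j ^ n j := by
    intro w hw0 hw1
    refine Summable.of_nonneg_of_le (fun n => ?_) (fun n => ?_) hν.summable
    · exact mul_nonneg ENNReal.toReal_nonneg (Finset.prod_nonneg fun k _ => pow_nonneg (hw0 k) _)
    · exact mul_le_of_le_one_right ENNReal.toReal_nonneg
        (Finset.prod_le_one (fun k _ => pow_nonneg (hw0 k) _) fun k _ =>
          pow_le_one₀ (hw0 k) (hw1 k))
  have hrhs := (hν.add (hsum y h0 h1).hasSum).mul_left (1 / 2)
  have hlhs := (hsum (fun j => (1 + y j) / 2) (fun j => by linarith [h0 j])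
    (fun j => by linarith [h1 j])).hasSum
  have := hasSum_le (fun n => ?_) hlhs hrhs
  · rw [batchPGF, batchPGF]
    linarith
  · have := mul_le_mul_of_nonneg_left (prod_half_one_add_le Finset.univ y h0 h1 n)
      (ENNReal.toReal_nonneg (a := ν n))
    linarith

section ChangeOfVariables

variable {E : Type*} [NormedAddCommGroup E] [NormedSpace ℝ E]

lemma setIntegral_Ioc_sub_left (f : ℝ → E) {s : ℝ} (t : ℝ) (hs : 0 ≤ s) :
    ∫ u in Set.Ioc (t - s) t, f (t - u) = ∫ τ in (0)..s, f τ := by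
  rw [← intervalIntegral.integral_of_le (by linarith), intervalIntegral.integral_comp_sub_left]
  simp

lemma setIntegral_Icc_sub_left (f : ℝ → E) {s t : ℝ} (hst : s ≤ t) :
    ∫ u in Set.Icc 0 (t - s), f (t - u) = ∫ τ in s..t, f τ := by
  rw [integral_Icc_eq_integral_Ioc, ← intervalIntegral.integral_of_le (by linarith),
    intervalIntegral.integral_comp_sub_left]
  simp

end ChangeOfVariables

section Network

variable {Ω : Type*} [mΩ : MeasurableSpace Ω] {P : Measure Ω} {J : ℕ}
  {lam : ℝ≥0} {ν : PMF (Fin J → ℕ)} {q : Fin J → Fin J → ℝ → ℝ} {T : ℕ → Ω → ℝ}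
  {S : ℕ → Ω → Fin J → ℕ} {X : ℕ → Fin J → ℕ → ℝ → Ω → Option (Fin J)}

namespace IsNetwork

lemma measurableSet_present (h : IsNetwork P lam ν q T S X) (i : ℕ) :
    MeasurableSet {p : ℝ × Ω | 0 ≤ p.1 ∧ ∃ j, ∃ l < S i p.2 j, ∃ k, X i j l p.1 p.2 = some k} := by
  have : {p : ℝ × Ω | 0 ≤ p.1 ∧ ∃ j, ∃ l < S i p.2 j, ∃ k, X i j l p.1 p.2 = some k}
      = ⋃ j, ⋃ l, ⋃ k, {p : ℝ × Ω | l < S i p.2 j} ∩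
        {p : ℝ × Ω | 0 ≤ p.1 ∧ X i j l p.1 p.2 = some k} := by
    ext p
    simp only [Set.mem_ofPred_eq, Set.mem_iUnion, Set.mem_inter_iff]
    constructor
    · rintro ⟨h0, j, l, hl, k, hk⟩
      exact ⟨j, l, k, hl, h0, hk⟩
    · rintro ⟨j, l, k, hl, h0, hk⟩
      exact ⟨h0, j, l, hl, k, hk⟩
  rw [this]
  refine .iUnion fun j => .iUnion fun l => .iUnion fun k => .inter ?_
    (h.measurableSet_route_prod i j l k)
  exact measurableSet_lt measurable_const
    ((measurable_pi_iff.1 (h.measurable_batch i) j).comp measurable_snd)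

variable [IsProbabilityMeasure P]

lemma stayProbExt_mem_Icc (h : IsNetwork P lam ν q T S X) (j : Fin J) (τ : ℝ) :
    stayProbExt q j τ ∈ Set.Icc (0 : ℝ) 1 := by
  have h0 := h.norm_meanWeight_le (z := fun _ => ((0 : ℝ) : ℂ)) (by simp) j τ
  -- The weight `-1` has mean `1 - 2Q`, and `|1 - 2Q| ≤ 1` yields `0 ≤ Q ≤ 1`.
  have h1 := h.norm_meanWeight_le (z := fun _ => ((-1 : ℝ) : ℂ)) (by simp) j τ
  rw [meanWeight_ofReal, Complex.norm_real, Real.norm_eq_abs, abs_le] at h0 h1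
  constructor <;> linarith

lemma killProb_mem_Icc (h : IsNetwork P lam ν q T S X) {s : ℝ} (hs : |s| ≤ 1) (τ : ℝ) :
    killProb ν q s τ ∈ Set.Icc (0 : ℝ) 2 := by
  have h0 := h.norm_complexPGF_meanWeight_le (z := fun _ => (s : ℂ)) (fun _ => by simpa using hs) τ
  rw [complexPGF_meanWeight_ofReal, Complex.norm_real, Real.norm_eq_abs, abs_le] at h0
  constructor <;> linarith

lemma measurable_killProb (h : IsNetwork P lam ν q T S X) {s : ℝ} (hs : |s| ≤ 1) :
    Measurable (killProb ν q s) := by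
  have h0 := h.measurable_complexPGF_meanWeight (z := fun _ => (s : ℂ)) (fun _ => by simpa using hs)
  simp_rw [complexPGF_meanWeight_ofReal] at h0
  have h1 := (Complex.measurable_re.comp h0).const_sub 1
  convert! h1 using 1
  ext τ
  simp

lemma intervalIntegrable_killProb (h : IsNetwork P lam ν q T S X) {s : ℝ} (hs : |s| ≤ 1)
    (a b : ℝ) : IntervalIntegrable (killProb ν q s) volume a b := by
  refine (intervalIntegrable_const (c := (2 : ℝ))).mono_fun
    (h.measurable_killProb hs).aestronglyMeasurable (ae_of_all _ fun τ => ?_)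
  have := h.killProb_mem_Icc hs τ
  simpa [abs_of_nonneg this.1] using this.2

/-- If somebody is present, killing each one present with probability `1/2` hits somebody with
probability at least `1/2`. Analytically, `1 - Q/2 = (1 + y)/2` with `y = 1 - Q`. -/
lemma half_killProb_zero_le (h : IsNetwork P lam ν q T S X) (τ : ℝ) :
    killProb ν q 0 τ / 2 ≤ killProb ν q (1 / 2) τ := by
  have h1 := batchPGF_half_one_add_le ν (fun j => 1 - stayProbExt q j τ)
    (fun j => by linarith [(h.stayProbExt_mem_Icc j τ).2])
    (fun j => by linarith [(h.stayProbExt_mem_Icc j τ).1])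
  have h2 : (fun j => (1 + (1 - stayProbExt q j τ)) / 2)
      = fun j => 1 - (1 - 1 / 2) * stayProbExt q j τ := by
    ext j; ring
  rw [h2] at h1
  simp only [killProb, sub_zero, one_mul]
  linarith

lemma integral_prod_pow_countVec_real (h : IsNetwork P lam ν q T S X) {s : ℝ} (hs : |s| ≤ 1)
    {D : Set ℝ} (hD : MeasurableSet D) {t : ℝ} (hDt : D ⊆ Set.Icc 0 t) :
    ∫ ω, ∏ k, s ^ countVec T S X D t ω k ∂P
      = Real.exp (-(lam * ∫ u in D, killProb ν q s (t - u))) := by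
  have h1 := h.integral_prod_pow_countVec (z := fun _ => (s : ℂ)) (fun _ => by simpa using hs) hD hDt
  simp_rw [complexPGF_meanWeight_ofReal] at h1
  apply Complex.ofReal_injective
  rw [← integral_complex_ofReal]
  push_cast
  rw [h1, ← integral_complex_ofReal]
  simp

/-- This is the generating function at `s = 0`: because `0 ^ 0 = 1`, the product is the indicator of
the zero vector. -/
lemma measureReal_countVec_eq_zero (h : IsNetwork P lam ν q T S X) {D : Set ℝ}
    (hD : MeasurableSet D) {t : ℝ} (hDt : D ⊆ Set.Icc 0 t) :
    P.real {ω | countVec T S X D t ω = 0}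
      = Real.exp (-(lam * ∫ u in D, killProb ν q 0 (t - u))) := by
  classical
  rw [← h.integral_prod_pow_countVec_real (by simp) hD hDt]
  have hms : MeasurableSet {ω | countVec T S X D t ω = 0} :=
    h.measurable_countVec hD (hDt.trans Set.Icc_subset_Iic_self) (measurableSet_singleton 0)
  rw [← integral_indicator_one hms]
  congr 1
  ext ω
  rw [Set.indicator_apply]
  split_ifs with h0
  · have h0' : countVec T S X D t ω = 0 := h0
    simp [h0']
  · have h0' : ∃ k, countVec T S X D t ω k ≠ 0 := by
      by_contra! hc
      exact h0 (funext hc)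
    obtain ⟨k, hk⟩ := h0'
    exact (Finset.prod_eq_zero (Finset.mem_univ k) (zero_pow hk)).symm

/-- Stationarity: the customers of the batches arriving in a window of length `s` before `t` have
the same joint law as all customers present at time `s`. -/
lemma map_countVec_Ioc (h : IsNetwork P lam ν q T S X) {s t : ℝ} (hs : 0 ≤ s) (hst : s ≤ t) :
    P.map (countVec T S X (Set.Ioc (t - s) t) t) = P.map (countVec T S X (Set.Icc 0 s) s) := by
  have hsub : Set.Ioc (t - s) t ⊆ Set.Icc 0 t :=
    Set.Ioc_subset_Icc_self.trans (Set.Icc_subset_Icc_left (by linarith))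
  have m1 := h.measurable_countVec (D := Set.Ioc (t - s) t) measurableSet_Ioc
    (hsub.trans Set.Icc_subset_Iic_self)
  have m2 := h.measurable_countVec (D := Set.Icc 0 s) (t := s) measurableSet_Icc
    Set.Icc_subset_Iic_self
  refine ext_of_integral_prod_pow fun z hz => ?_
  have hd : Measurable fun n : Fin J → ℕ => ∏ k, z k ^ n k := .of_discrete
  rw [integral_map m1.aemeasurable hd.aestronglyMeasurable,
    integral_map m2.aemeasurable hd.aestronglyMeasurable,
    h.integral_prod_pow_countVec hz measurableSet_Ioc hsub,
    h.integral_prod_pow_countVec hz measurableSet_Icc le_rfl]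
  congr 3
  rw [setIntegral_Ioc_sub_left (fun τ => 1 - complexPGF ν fun j => meanWeight q z j τ) t hs]
  have := setIntegral_Icc_sub_left (fun τ => 1 - complexPGF ν fun j => meanWeight q z j τ) hs
  rw [sub_zero] at this
  exact this.symm

/-- Recent arrivals, in `(t - s, t]`, reproduce the law at time `s`. The older ones change the count
only if one of them is still present, an event of probability `1 - exp(-x) ≤ x` with `x = λ ∫_s^t
κ_0`. Uniformity in `F` is what makes this a total variation estimate. -/
lemma measureReal_map_countVec_ge (h : IsNetwork P lam ν q T S X) {s t : ℝ} (hs : 0 ≤ s)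
    (hst : s ≤ t) (F : Set (Fin J → ℕ)) :
    (P.map (countVec T S X (Set.Icc 0 s) s)).real F - lam * ∫ τ in s..t, killProb ν q 0 τ
      ≤ (P.map (countVec T S X (Set.Icc 0 t) t)).real F := by
  have hsub1 : Set.Ioc (t - s) t ⊆ Set.Icc 0 t :=
    Set.Ioc_subset_Icc_self.trans (Set.Icc_subset_Icc_left (by linarith))
  have hsub2 : Set.Icc 0 (t - s) ⊆ Set.Icc 0 t := Set.Icc_subset_Icc_right (by linarith)
  have m1 := h.measurable_countVec (D := Set.Ioc (t - s) t) measurableSet_Ioc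
    (hsub1.trans Set.Icc_subset_Iic_self)
  have m2 := h.measurable_countVec (D := Set.Icc 0 (t - s)) measurableSet_Icc
    (hsub2.trans Set.Icc_subset_Iic_self)
  have m3 := h.measurable_countVec (D := Set.Icc 0 t) (t := t) measurableSet_Icc
    Set.Icc_subset_Iic_self
  have hF : MeasurableSet F := .of_discrete
  rw [← h.map_countVec_Ioc hs hst, map_measureReal_apply m1 hF, map_measureReal_apply m3 hF]
  have hvoid := h.measureReal_countVec_eq_zero (D := Set.Icc 0 (t - s)) measurableSet_Icc hsub2
  rw [setIntegral_Icc_sub_left (killProb ν q 0) hst] at hvoid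
  have hne : P.real {ω | countVec T S X (Set.Icc 0 (t - s)) t ω = 0}ᶜ
      ≤ lam * ∫ τ in s..t, killProb ν q 0 τ := by
    rw [probReal_compl_eq_one_sub (s := {ω | countVec T S X (Set.Icc 0 (t - s)) t ω = 0})
      (m2 (measurableSet_singleton 0)), hvoid]
    linarith [Real.add_one_le_exp (-(lam * ∫ τ in s..t, killProb ν q 0 τ))]
  have hun : Set.Icc 0 (t - s) ∪ Set.Ioc (t - s) t = Set.Icc 0 t :=
    Set.Icc_union_Ioc_eq_Icc (by linarith) (by linarith)
  have hdisj : Disjoint (Set.Icc 0 (t - s)) (Set.Ioc (t - s) t) := by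
    rw [Set.disjoint_left]
    rintro x ⟨_, hx⟩ ⟨hx', _⟩
    linarith
  have hae := h.ae_countVec_union measurableSet_Icc measurableSet_Ioc hdisj hsub2 hsub1
  rw [hun] at hae
  have hincl : P.real (countVec T S X (Set.Ioc (t - s) t) t ⁻¹' F)
      ≤ P.real (countVec T S X (Set.Icc 0 t) t ⁻¹' F
        ∪ {ω | countVec T S X (Set.Icc 0 (t - s)) t ω = 0}ᶜ) := by
    refine ENNReal.toReal_mono (measure_ne_top _ _) (measure_mono_ae ?_)
    filter_upwards [hae] with ω hω hF'
    by_cases h0 : countVec T S X (Set.Icc 0 (t - s)) t ω = 0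
    · left
      rw [h0, zero_add] at hω
      change countVec T S X (Set.Icc 0 t) t ω ∈ F
      rw [hω]
      exact hF'
    · exact Or.inr h0
  linarith [measureReal_union_le (μ := P) (countVec T S X (Set.Icc 0 t) t ⁻¹' F)
    {ω | countVec T S X (Set.Icc 0 (t - s)) t ω = 0}ᶜ]

lemma occupancyIntegral_eq : occupancyIntegral ν q
    = ∫⁻ τ in Set.Ioi (0 : ℝ), ENNReal.ofReal (killProb ν q 0 τ) := by
  refine setLIntegral_congr_fun measurableSet_Ioi fun τ hτ => ?_
  have h0 : (0 : ℝ) ≤ τ := le_of_lt hτ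
  simp [killProb, stayProbExt, h0]

lemma integrableOn_killProb (h : IsNetwork P lam ν q T S X) (hfin : occupancyIntegral ν q < ∞) :
    IntegrableOn (killProb ν q 0) (Set.Ioi 0) := by
  refine ⟨(h.measurable_killProb (by simp)).aestronglyMeasurable, ?_⟩
  rw [hasFiniteIntegral_iff_ofReal (ae_of_all _ fun τ => (h.killProb_mem_Icc (by simp) τ).1),
    ← occupancyIntegral_eq]
  exact hfin

lemma isErgodic_of_lt_top (h : IsNetwork P lam ν q T S X) (hfin : occupancyIntegral ν q < ∞) :
    IsErgodic P T S X := by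
  have hprob : ∀ t, IsProbabilityMeasure (P.map (countVec T S X (Set.Icc 0 t) t)) := fun t =>
    Measure.isProbabilityMeasure_map
      (h.measurable_countVec measurableSet_Icc Set.Icc_subset_Iic_self).aemeasurable
  have hint := h.integrableOn_killProb hfin
  set L := ∫ τ in Set.Ioi 0, killProb ν q 0 τ with hL
  have hlim : Tendsto (fun s => (lam : ℝ) * (L - ∫ τ in (0)..s, killProb ν q 0 τ)) atTop (𝓝 0) := by
    have := ((intervalIntegral_tendsto_integral_Ioi 0 hint tendsto_id).const_sub L).const_mul
      (lam : ℝ)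
    rwa [← hL, sub_self, mul_zero] at this
  have hle : ∀ t, 0 ≤ t → ∫ τ in (0)..t, killProb ν q 0 τ ≤ L := by
    intro t ht
    rw [intervalIntegral.integral_of_le ht]
    exact setIntegral_mono_set hint (ae_of_all _ fun τ => (h.killProb_mem_Icc (by simp) τ).1)
      (Set.Ioc_subset_Ioi_self.eventuallyLE)
  obtain ⟨p, hp⟩ := exists_pmf_tendsto
    (μ := fun t => P.map (countVec T S X (Set.Icc 0 t) t)) (fun ε hε => by
      obtain ⟨s, hs0, hs⟩ := ((eventually_ge_atTop 0).and (hlim.eventually (gt_mem_nhds hε))).exists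
      refine ⟨s, fun t ht F => ?_⟩
      refine le_trans ?_ (h.measureReal_map_countVec_ge hs0 ht F)
      have hadd := intervalIntegral.integral_add_adjacent_intervals
        (h.intervalIntegrable_killProb (s := 0) (by simp) 0 s)
        (h.intervalIntegrable_killProb (s := 0) (by simp) s t)
      have hmul := mul_le_mul_of_nonneg_left
        (show ∫ τ in s..t, killProb ν q 0 τ ≤ L - ∫ τ in (0)..s, killProb ν q 0 τ by
          linarith [hle t (hs0.trans ht)]) lam.coe_nonneg
      linarith)
  exact ⟨p, fun n => (hp n).congr fun t => (h.measure_occupancy_eq t n).symm⟩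

lemma tendsto_integral_killProb_atTop (h : IsNetwork P lam ν q T S X)
    (hinf : occupancyIntegral ν q = ∞) :
    Tendsto (fun t => ∫ τ in (0)..t, killProb ν q 0 τ) atTop atTop := by
  have hnn : ∀ τ, 0 ≤ killProb ν q 0 τ := fun τ => (h.killProb_mem_Icc (by simp) τ).1
  have hii := h.intervalIntegrable_killProb (s := 0) (by simp)
  have hmono : Monotone fun t => ∫ τ in (0)..t, killProb ν q 0 τ := by
    intro t t' htt
    have h1 := intervalIntegral.integral_add_adjacent_intervals (hii 0 t) (hii t t')
    have h2 := intervalIntegral.integral_nonneg_of_forall (μ := volume) htt hnn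
    simp only
    linarith
  refine (tendsto_atTop_of_monotone hmono).resolve_right ?_
  rintro ⟨l, hl⟩
  have hint : IntegrableOn (killProb ν q 0) (Set.Ioi 0) := by
    refine integrableOn_Ioi_of_intervalIntegral_norm_tendsto l 0
      (fun t => ((hii 0 t).1)) tendsto_id ?_
    simp_rw [Real.norm_of_nonneg (hnn _)]
    exact hl
  have := hint.2
  rw [hasFiniteIntegral_iff_ofReal (ae_of_all _ hnn), ← occupancyIntegral_eq, hinf] at this
  exact lt_irrefl _ this

/-- The value `s = 0` would control only the empty state; a weight strictly between `0` and `1`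
controls every state `n` at the cost of the constant `2 ^ |n|`. -/
lemma lt_top_of_isErgodic (h : IsNetwork P lam ν q T S X) (hlam : 0 < lam)
    (herg : IsErgodic P T S X) : occupancyIntegral ν q < ∞ := by
  by_contra hc
  have hatTop := h.tendsto_integral_killProb_atTop (not_lt_top_iff.1 hc)
  obtain ⟨p, hp⟩ := herg
  have hs : |(1 / 2 : ℝ)| ≤ 1 := by rw [abs_of_pos] <;> norm_num
  have hexp : Tendsto (fun t => Real.exp (-(lam * ∫ τ in (0)..t, killProb ν q (1 / 2) τ))) atTop
      (𝓝 0) := by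
    refine Real.tendsto_exp_neg_atTop_nhds_zero.comp ?_
    refine tendsto_atTop_mono' _ ?_
      (hatTop.const_mul_atTop (show (0 : ℝ) < lam / 2 by positivity))
    filter_upwards [eventually_ge_atTop 0] with t ht
    have := intervalIntegral.integral_mono ht
      ((h.intervalIntegrable_killProb (s := 0) (by simp) 0 t).div_const 2)
      (h.intervalIntegrable_killProb hs 0 t) h.half_killProb_zero_le
    rw [intervalIntegral.integral_div] at this
    have := mul_le_mul_of_nonneg_left this lam.coe_nonneg
    linarith
  have hzero : ∀ n, p n = 0 := by
    intro n
    -- Markov's inequality: on `{N(t) = n}` the variable `2^{|n|} · 2^{-|N(t)|}` equals `1`.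
    have hbound : ∀ t, 0 ≤ t → P.real {ω | ∀ k, occupancy T S X t k ω = n k}
        ≤ 2 ^ (∑ k, n k) * Real.exp (-(lam * ∫ τ in (0)..t, killProb ν q (1 / 2) τ)) := by
      intro t ht
      have hm := h.measurable_countVec (D := Set.Icc 0 t) (t := t) measurableSet_Icc
        Set.Icc_subset_Iic_self
      have hgf := h.integral_prod_pow_countVec_real hs (D := Set.Icc 0 t) measurableSet_Icc le_rfl
      have hcv := setIntegral_Icc_sub_left (killProb ν q (1 / 2)) ht
      rw [sub_zero] at hcv
      rw [hcv] at hgf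
      rw [← hgf, measureReal_def, h.measure_occupancy_eq, ← measureReal_def,
        map_measureReal_apply hm (measurableSet_singleton n), ← integral_const_mul,
        ← integral_indicator_one (hm (measurableSet_singleton n))]
      have hd : Measurable fun n : Fin J → ℕ => ∏ k, (1 / 2 : ℝ) ^ n k := .of_discrete
      refine integral_mono ?_ ?_ fun ω => ?_
      · exact (integrable_const (1 : ℝ)).indicator (hm (measurableSet_singleton n))
      · refine Integrable.const_mul (Integrable.of_bound (hd.comp hm).aestronglyMeasurable 1
          (ae_of_all _ fun ω => ?_)) _
        rw [Function.comp_apply, Real.norm_of_nonneg (by positivity)]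
        exact Finset.prod_le_one (fun _ _ => by positivity)
          fun _ _ => pow_le_one₀ (by norm_num) (by norm_num)
      · refine Set.indicator_apply_le' (fun hω => ?_) fun _ => by positivity
        have hω' : countVec T S X (Set.Icc 0 t) t ω = n := hω
        simp only [hω', Pi.one_apply]
        rw [Finset.prod_pow_eq_pow_sum, ← mul_pow]
        norm_num
    have hlim : Tendsto (fun t => P.real {ω | ∀ k, occupancy T S X t k ω = n k}) atTop
        (𝓝 0) := by
      refine squeeze_zero' (Eventually.of_forall fun t => measureReal_nonneg)
        ((eventually_ge_atTop 0).mono hbound) ?_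
      simpa using hexp.const_mul ((2 : ℝ) ^ (∑ k, n k))
    have hlim' := (ENNReal.tendsto_toReal (p.apply_ne_top n)).comp (hp n)
    have := tendsto_nhds_unique hlim' hlim
    exact ((ENNReal.toReal_eq_zero_iff _).1 this).resolve_right (p.apply_ne_top n)
  have := p.tsum_coe
  simp [hzero] at this

/-! ### Expected occupancy time of a batch -/

lemma measure_present (h : IsNetwork P lam ν q T S X) (i : ℕ) (τ : ℝ) :
    P {ω | 0 ≤ τ ∧ ∃ j, ∃ l < S i ω j, ∃ k, X i j l τ ω = some k}
      = ENNReal.ofReal (killProb ν q 0 τ) := by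
  classical
  set A := {ω | 0 ≤ τ ∧ ∃ j, ∃ l < S i ω j, ∃ k, X i j l τ ω = some k} with hA
  have hms : MeasurableSet A := measurable_prodMk_left (h.measurableSet_present i)
  have h1 := h.integral_batchWeight (z := fun _ => ((0 : ℝ) : ℂ)) (by simp) i τ
  rw [complexPGF_meanWeight_ofReal] at h1
  -- With all weights `0`, the batch weight indicates that nobody is present.
  have h2 : ∀ ω, batchWeight (fun _ => ((0 : ℝ) : ℂ)) (X i) (τ, S i ω) ω
      = ((Aᶜ.indicator 1 ω : ℝ) : ℂ) := by
    intro ω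
    rw [Set.indicator_apply]
    split_ifs with hω
    · refine (Finset.prod_eq_one fun j _ => Finset.prod_eq_one fun l hl => ?_).trans (by simp)
      refine Finset.prod_eq_one fun k _ => if_neg fun hk => hω ?_
      exact ⟨hk.1, j, l, by simpa using hl, k, hk.2⟩
    · obtain ⟨h0, j, l, hl, k, hk⟩ := not_not.1 hω
      refine Eq.trans (Finset.prod_eq_zero (Finset.mem_univ j)
        (Finset.prod_eq_zero (Finset.mem_range.2 hl)
          (Finset.prod_eq_zero (Finset.mem_univ k) ?_))) Complex.ofReal_zero.symm
      simp [h0, hk]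
  simp_rw [h2] at h1
  rw [integral_complex_ofReal, integral_indicator_one hms.compl] at h1
  have h3 := Complex.ofReal_injective h1
  rw [probReal_compl_eq_one_sub hms] at h3
  rw [← ofReal_measureReal]
  congr 1
  linarith

/-- The expected occupancy time of a batch. -/
lemma lintegral_batchOccupancyTime (h : IsNetwork P lam ν q T S X) (i : ℕ) :
    ∫⁻ ω, batchOccupancyTime S X i ω ∂P = occupancyIntegral ν q := by
  have hms := h.measurableSet_present i
  -- Tonelli: the product measure of the presence set is computed by slicing in time and by slicing
  -- in chance.
  have h1 := Measure.prod_apply (μ := volume) (ν := P) hms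
  rw [Measure.prod_apply_symm hms] at h1
  refine Eq.trans h1 ?_
  rw [occupancyIntegral_eq, setLIntegral_congr Ioi_ae_eq_Ici,
    ← lintegral_indicator measurableSet_Ici]
  refine lintegral_congr fun τ => ?_
  rw [Set.indicator_apply]
  split_ifs with h0
  · exact h.measure_present i τ
  · convert! measure_empty (μ := P)
    exact Set.eq_empty_of_forall_notMem fun ω hω => h0 hω.1

end IsNetwork

end Network

end BatchNetwork

theorem theorem4p1 {Ω : Type*} [MeasurableSpace Ω] (P : Measure Ω) [IsProbabilityMeasure P]
    (J : ℕ) (lam : ℝ≥0) (hlam : 0 < lam) (ν : PMF (Fin J → ℕ)) (q : Fin J → Fin J → ℝ → ℝ)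
    (T : ℕ → Ω → ℝ) (S : ℕ → Ω → Fin J → ℕ) (X : ℕ → Fin J → ℕ → ℝ → Ω → Option (Fin J))
    (h : BatchNetwork.IsNetwork P lam ν q T S X) :
    (∀ i, ∫⁻ ω, BatchNetwork.batchOccupancyTime S X i ω ∂P
        = BatchNetwork.occupancyIntegral ν q) ∧
      (∀ i, BatchNetwork.IsErgodic P T S X ↔
        ∫⁻ ω, BatchNetwork.batchOccupancyTime S X i ω ∂P < ∞) := by
  refine ⟨h.lintegral_batchOccupancyTime, fun i => ?_⟩
  rw [h.lintegral_batchOccupancyTime i]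
  exact ⟨h.lt_top_of_isErgodic hlam, h.isErgodic_of_lt_top⟩
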